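/- Let MMDS (Minimum Membership Dominating Set) be the following problem: given a finite simple undirected graph $G=(V,E)$ and a positive integer $k$, decide whether there is a set $S\subseteq V$ such that every vertex of $G$ lies in $S$ or has a neighbour in $S$, and $|N[u]\cap S|\le k$ for every $u\in V$, where $N[u]$ is the closed neighbourhood of $u$. Let $\mathrm{vc}$ denote the size of a minimum vertex cover of $G$. Assume the Exponential Time Hypothesis (ETH): there is a constant $\delta>0$ such that 3-SAT on formulas with $n$ variables and $m$ clauses cannot be decided in time $2^{\delta n}(n+m)^{O(1)}$. Then there is no algorithm that decides MMDS in time $2^{o(\mathrm{vc})}\cdot|V|^{O(1)}$; that is, there are no function $f:\mathbb{N}\to\mathbb{R}$ with $f(v)=o(v)$ as $v\to\infty$ and constants $C,c$ for which some algorithm decides every instance $(G,k)$ in at most $C\cdot 2^{f(\mathrm{vc})}(|V|+1)^{c}$ steps. -/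

import Mathlib

open Filter Asymptotics

/-! ### Deciding a problem on a multi-stack Turing machine -/

/-- A deterministic Turing machine (with finitely many stacks, finite stack alphabets, finitely many
program labels and finitely many internal states) that receives its input as a word over `Γ` on its
input stack and answers, when it halts, through its internal state. -/
structure DecisionTM (Γ : Type) where
  /-- the underlying machine -/
  tm : Turing.FinTM2
  /-- every stack has a finite alphabet -/
  finiteAlphabet : ∀ k, Finite (tm.Γ k)
  /-- the alphabet of the input stack is `Γ` -/
  inputAlphabet : tm.Γ tm.k₀ ≃ Γ
  /-- the internal states in which halting means the answer "yes" -/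
  accept : tm.σ → Bool

/-- On the input word `w`, the machine halts after at most `t` steps, and its answer is "yes" if and
only if `p` holds. -/
def DecisionTM.AnswersWithin {Γ : Type} (M : DecisionTM Γ) (w : List Γ) (p : Prop) (t : ℕ) : Prop :=
  ∃ cfg : M.tm.Cfg, cfg.l = none ∧ (M.accept cfg.var = true ↔ p) ∧
    Nonempty (StateTransition.EvalsToInTime M.tm.step
      (Turing.initList M.tm (w.map M.inputAlphabet.symm)) (some cfg) t)

/-- There is an algorithm that decides the problem `P` (whose instances `a` are presented as the words
`enc a`) in at most `T a` steps on every instance `a`. -/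
def DecidableInTime {α Γ : Type} (enc : α → List Γ) (P : α → Prop) (T : α → ℝ) : Prop :=
  ∃ M : DecisionTM Γ, ∀ a, ∃ t : ℕ, (t : ℝ) ≤ T a ∧ M.AnswersWithin (enc a) (P a) t

/-! ### 3-SAT and the Exponential Time Hypothesis -/

/-- A Boolean formula in conjunctive normal form with at most three literals per clause. The literal
`(i, true)` is the variable `i` and `(i, false)` is its negation. -/
structure ThreeCNF where
  /-- the number of variables -/
  n : ℕ
  /-- the clauses -/
  clauses : List (List (Fin n × Bool))
  /-- each clause has at most three literals -/
  length_le : ∀ c ∈ clauses, c.length ≤ 3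

namespace ThreeCNF

/-- The number of clauses. -/
def m (φ : ThreeCNF) : ℕ := φ.clauses.length

/-- Some truth assignment makes at least one literal of each clause true. -/
def Satisfiable (φ : ThreeCNF) : Prop :=
  ∃ τ : Fin φ.n → Bool, ∀ c ∈ φ.clauses, ∃ l ∈ c, τ l.1 = l.2

/-- The symbols with which formulas are written. -/
inductive Symbol
  | tally
  | pos
  | neg
  | sep

/-- A literal is written as the index of its variable in unary, followed by its sign. -/
def encodeLiteral {n : ℕ} (l : Fin n × Bool) : List Symbol :=
  List.replicate l.1 Symbol.tally ++ [if l.2 then Symbol.pos else Symbol.neg]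

/-- A formula is written as its number of variables in unary, followed by its clauses, each of these
parts being closed by a separator. -/
def encode (φ : ThreeCNF) : List Symbol :=
  List.replicate φ.n Symbol.tally ++ [Symbol.sep] ++
    φ.clauses.flatMap fun c => c.flatMap encodeLiteral ++ [Symbol.sep]

end ThreeCNF

/-- The Exponential Time Hypothesis: there is `δ > 0` such that 3-SAT with `n` variables and `m`
clauses cannot be solved in time `2 ^ (δ * n) * (n + m) ^ O(1)`. -/
def ExponentialTimeHypothesis : Prop :=
  ∃ δ : ℝ, 0 < δ ∧ ¬ ∃ (C : ℝ) (c : ℕ),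
    DecidableInTime ThreeCNF.encode ThreeCNF.Satisfiable
      (fun φ => C * (2 : ℝ) ^ (δ * (φ.n : ℝ)) * ((φ.n : ℝ) + (φ.m : ℝ) + 1) ^ c)

/-! ### Minimum Membership Dominating Set -/

/-- `S` is a dominating set: each vertex is in `S` or has a neighbour in `S`. -/
def SimpleGraph.IsDominatingSet {V : Type*} (G : SimpleGraph V) (S : Set V) : Prop :=
  ∀ v, v ∈ S ∨ ∃ u ∈ S, G.Adj v u

/-- The membership `|N[u] ∩ S|` of the vertex `u` in `S`. -/
noncomputable def SimpleGraph.membership {V : Type*} (G : SimpleGraph V) (u : V) (S : Set V) : ℕ∞ :=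
  (insert u (G.neighborSet u) ∩ S).encard

/-- An instance of Minimum Membership Dominating Set: a finite simple graph and a positive integer. -/
structure MMDSInstance where
  /-- the number of vertices -/
  n : ℕ
  /-- the graph -/
  G : SimpleGraph (Fin n)
  /-- the bound on the membership -/
  k : ℕ
  k_pos : 0 < k

namespace MMDSInstance

/-- The graph has a dominating set in which every vertex has membership at most `k`. -/
def IsYes (I : MMDSInstance) : Prop :=
  ∃ S : Set (Fin I.n), I.G.IsDominatingSet S ∧ ∀ u, I.G.membership u S ≤ (I.k : ℕ∞)

/-- The size of a minimum vertex cover of the graph. -/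
noncomputable def vc (I : MMDSInstance) : ℕ := I.G.vertexCoverNum.toNat

open Classical in
/-- An instance is written as the number of vertices in unary, the adjacency matrix row by row, and
`k` in unary, with separators (`none`) in between. -/
noncomputable def encode (I : MMDSInstance) : List (Option Bool) :=
  List.replicate I.n (some true) ++ [none] ++
    ((List.finRange I.n).flatMap fun i => (List.finRange I.n).map fun j =>
      some (decide (I.G.Adj i j))) ++
    [none] ++ List.replicate I.k (some true)

end MMDSInstance

/-! The theorem rests on a polynomial-time reduction from 3-SAT with `n` variables to MMDS whose
graphs have vertex cover number at most `2n + 4`. The graph is bipartite. One side has `D = 2n + 4`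
positions (literal vertices) in `k = n + 2` pairs: pair `i + 2` holds the two literals of variable
`i`, pairs `0` and `1` are auxiliary. The other side consists of rows; a row is given by the set of
positions adjacent to it, and every row occurs at least `D = 2k` times. There is a row for each
pair, a row for position `1` alone, a row for all positions, and for each clause a row for its
literals and position `0`. The bound on the membership is `k`. The positions form a vertex cover.

From a solution to an assignment: if a solution avoids all positions of a nonempty row, then the
more than `k` copies of this row must dominate themselves, so all are chosen, and a position of the
row has membership above `k`. Hence the chosen positions hit every row (`exists_position_of_count`).
By the full row at most `k` positions are chosen (`encard_positions_le`), so exactly one from each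
pair, which is an assignment. Position `1` is chosen, so `0` is not, and every clause row is hit in
a true literal. Position `0` makes the row of an empty clause nonempty; copies of an empty row would
be isolated vertices and constrain nothing.

From an assignment to a solution (`isYes_of_choice`): choose position `1`, the true literals, one
position of pair `1`, and one copy of each pair row to dominate the positions. All memberships are
at most `max k 2`, and pair `1` ensures `2 ≤ k` even without variables.

If `f(v) = o(v)`, then `f(v) ≤ (δ/2) v + K`, so `2 ^ f(vc)` is at most a constant times `2 ^ (δ n)`,
against ETH; the size of the graph and the cost of the reduction only enter the polynomial factor.

Since time means steps of a Turing machine, the reduction is an explicit program in a small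
structured language. `Runs.reachesIn` compiles programs without changing the number of steps,
`Runs.answersWithin` runs a decision machine on the output, and `runsIn_reduction` gives the output
and a quartic time bound. -/

open ThreeCNF (Symbol)

/-! ### Structured programs on stacks -/

/-- Structured programs that work on stacks indexed by `K` with symbols from `Γ`. -/
inductive StackProg (K Γ : Type) : Type
  /-- push a symbol -/
  | push (k : K) (a : Γ)
  /-- pop a symbol and push it onto each stack of a list -/
  | move (k : K) (ks : List K)
  /-- sequential composition -/
  | seq (P Q : StackProg K Γ)
  /-- branch on the top of a stack -/
  | ite (k : K) (p : Option Γ → Bool) (P Q : StackProg K Γ)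
  /-- repeat while the top of a stack satisfies a condition -/
  | loop (k : K) (p : Option Γ → Bool) (P : StackProg K Γ)

namespace StackProg

variable {K Γ : Type}

section Semantics

variable [DecidableEq K]

/-- Push a symbol onto each stack of a list. -/
def pushAll (a : Γ) (ks : List K) (s : K → List Γ) : K → List Γ :=
  ks.foldl (fun s k => Function.update s k (a :: s k)) s

@[simp] theorem pushAll_nil (a : Γ) (s : K → List Γ) : pushAll a [] s = s := rfl

@[simp] theorem pushAll_cons (a : Γ) (k : K) (ks : List K) (s : K → List Γ) :
    pushAll a (k :: ks) s = pushAll a ks (Function.update s k (a :: s k)) := rfl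

/-- `Runs P s s' t`: started with the stacks `s`, the program `P` ends with the stacks `s'` after
exactly `t` steps. -/
inductive Runs : StackProg K Γ → (K → List Γ) → (K → List Γ) → ℕ → Prop
  | push (k : K) (a : Γ) (s : K → List Γ) : Runs (.push k a) s (Function.update s k (a :: s k)) 1
  | move {k : K} {ks : List K} {s : K → List Γ} {a : Γ} {r : List Γ} (h : s k = a :: r) :
      Runs (.move k ks) s (pushAll a ks (Function.update s k r)) 1
  | seq {P Q : StackProg K Γ} {s s' s'' : K → List Γ} {t t' : ℕ} (hP : Runs P s s' t)
      (hQ : Runs Q s' s'' t') : Runs (.seq P Q) s s'' (t + t')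
  | ite_true {k : K} {p : Option Γ → Bool} {P Q : StackProg K Γ} {s s' : K → List Γ} {t : ℕ}
      (h : p (s k).head? = true) (hP : Runs P s s' t) : Runs (.ite k p P Q) s s' (1 + t)
  | ite_false {k : K} {p : Option Γ → Bool} {P Q : StackProg K Γ} {s s' : K → List Γ} {t : ℕ}
      (h : p (s k).head? = false) (hQ : Runs Q s s' t) : Runs (.ite k p P Q) s s' (1 + t)
  | loop_true {k : K} {p : Option Γ → Bool} {P : StackProg K Γ} {s s' s'' : K → List Γ} {t t' : ℕ}
      (h : p (s k).head? = true) (hP : Runs P s s' t) (hL : Runs (.loop k p P) s' s'' t') :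
      Runs (.loop k p P) s s'' (1 + t + t')
  | loop_false {k : K} {p : Option Γ → Bool} {P : StackProg K Γ} {s : K → List Γ}
      (h : p (s k).head? = false) : Runs (.loop k p P) s s 1

end Semantics

/-! ### Compilation to a Turing machine -/

/-- The program labels of the compiled program. -/
def Label : StackProg K Γ → Type
  | push _ _ => Unit
  | move _ _ => Unit
  | seq P Q => P.Label ⊕ Q.Label
  | ite _ _ P Q => Option (P.Label ⊕ Q.Label)
  | loop _ _ P => Option P.Label

instance finite_label : (P : StackProg K Γ) → Finite P.Label
  | push _ _ => inferInstanceAs (Finite Unit)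
  | move _ _ => inferInstanceAs (Finite Unit)
  | seq P Q =>
    have := finite_label P
    have := finite_label Q
    inferInstanceAs (Finite (P.Label ⊕ Q.Label))
  | ite _ _ P Q =>
    have := finite_label P
    have := finite_label Q
    inferInstanceAs (Finite (Option (P.Label ⊕ Q.Label)))
  | loop _ _ P =>
    have := finite_label P
    inferInstanceAs (Finite (Option P.Label))

/-- The label at which the compiled program starts. -/
def entry : (P : StackProg K Γ) → P.Label
  | push _ _ => ()
  | move _ _ => ()
  | seq P _ => Sum.inl P.entry
  | ite _ _ _ _ => none
  | loop _ _ _ => none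

variable {K' : Type} {Γ' : K' → Type} {Λ σ : Type}

/-- The alphabets of a machine that has the stacks `K` of a program next to other stacks `K'`. -/
abbrev JoinAlphabet (K Γ : Type) (Γ' : K' → Type) : K ⊕ K' → Type :=
  Sum.elim (fun _ => Γ) Γ'

/-- Put the stacks of a program next to other stacks. -/
def joinStacks (s : K → List Γ) (S : ∀ k, List (Γ' k)) : ∀ k, List (JoinAlphabet K Γ Γ' k)
  | .inl k => s k
  | .inr k => S k

/-- Push the symbol in the register onto each stack of a list, then go to `exit`. -/
def pushCode [Inhabited Γ] (exit : Λ) :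
    List K → Turing.TM2.Stmt (JoinAlphabet K Γ Γ') Λ (Option Γ × σ)
  | [] => .goto fun _ => exit
  -- The default is used only by a `move` from an empty stack, for which `Runs` has no rule.
  | k :: ks => .push (.inl k) (fun v => v.1.getD default) (pushCode exit ks)

/-- The machine statements of a program, in a machine into which its labels are embedded by `emb`;
when the program ends, the machine continues at the label `exit`. -/
def code [Inhabited Γ] : (P : StackProg K Γ) → (P.Label → Λ) → Λ → P.Label →
    Turing.TM2.Stmt (JoinAlphabet K Γ Γ') Λ (Option Γ × σ)
  | push k a, _, exit, _ => .push (.inl k) (fun _ => a) (.goto fun _ => exit)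
  | move k ks, _, exit, _ => .pop (.inl k) (fun v a => (a, v.2)) (pushCode exit ks)
  | seq P Q, emb, exit, l =>
    match l with
    | .inl l => P.code (fun l => emb (.inl l)) (emb (.inr Q.entry)) l
    | .inr l => Q.code (fun l => emb (.inr l)) exit l
  | ite k p P Q, emb, exit, l =>
    match l with
    | none => .peek (.inl k) (fun v a => (a, v.2)) (.branch (fun v => p v.1)
        (.goto fun _ => emb (some (.inl P.entry))) (.goto fun _ => emb (some (.inr Q.entry))))
    | some (.inl l) => P.code (fun l => emb (some (.inl l))) exit l
    | some (.inr l) => Q.code (fun l => emb (some (.inr l))) exit l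
  | loop k p P, emb, exit, l =>
    match l with
    | none => .peek (.inl k) (fun v a => (a, v.2)) (.branch (fun v => p v.1)
        (.goto fun _ => emb (some P.entry)) (.goto fun _ => exit))
    | some l => P.code (fun l => emb (some l)) (emb none) l

/-- Repeated evaluation of `f` leads from `a` to `b` in exactly `t` steps. -/
def ReachesIn {α : Type*} (f : α → Option α) (t : ℕ) (a b : α) : Prop :=
  (flip Bind.bind f)^[t] (some a) = some b

theorem ReachesIn.trans {α : Type*} {f : α → Option α} {t t' : ℕ} {a b c : α}
    (h : ReachesIn f t a b) (h' : ReachesIn f t' b c) : ReachesIn f (t + t') a c := by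
  unfold ReachesIn at *
  rw [add_comm, Function.iterate_add_apply, h, h']

theorem ReachesIn.single {α : Type*} {f : α → Option α} {a b : α} (h : f a = some b) :
    ReachesIn f 1 a b := h

variable [DecidableEq K] [DecidableEq K']

theorem update_joinStacks_inl (s : K → List Γ) (S : ∀ k, List (Γ' k)) (k : K) (x : List Γ) :
    Function.update (joinStacks s S) (.inl k) x = joinStacks (Function.update s k x) S := by
  funext i
  by_cases h : i = .inl k
  · subst h
    exact (Function.update_self _ _ _).trans (Function.update_self k x s).symm
  · refine (Function.update_of_ne h _ _).trans ?_
    rcases i with i | i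
    · exact (Function.update_of_ne (fun e => h (congrArg _ e)) x s).symm
    · rfl

theorem update_joinStacks_inr (s : K → List Γ) (S : ∀ k, List (Γ' k)) (k : K') (x : List (Γ' k)) :
    Function.update (joinStacks s S) (.inr k) x = joinStacks s (Function.update S k x) := by
  funext i
  by_cases h : i = .inr k
  · subst h
    exact (Function.update_self _ _ _).trans (Function.update_self k x S).symm
  · refine (Function.update_of_ne h _ _).trans ?_
    rcases i with i | i
    · rfl
    · exact (Function.update_of_ne (fun e => h (congrArg _ e)) x S).symm

theorem stepAux_pop_inl (k : K) (q : Turing.TM2.Stmt (JoinAlphabet K Γ Γ') Λ (Option Γ × σ))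
    (r : Option Γ) (v : σ) (s : K → List Γ) (S : ∀ k, List (Γ' k)) :
    Turing.TM2.stepAux (.pop (.inl k) (fun v a => (a, v.2)) q) (r, v) (joinStacks s S) =
      Turing.TM2.stepAux q ((s k).head?, v)
        (joinStacks (Function.update s k (s k).tail) S) :=
  congrArg (Turing.TM2.stepAux q ((s k).head?, v)) (update_joinStacks_inl s S k (s k).tail)

theorem stepAux_pushCode [Inhabited Γ] (exit : Λ) (ks : List K) (a : Γ) (v : σ) (s : K → List Γ)
    (S : ∀ k, List (Γ' k)) :
    Turing.TM2.stepAux (pushCode exit ks) (some a, v) (joinStacks s S) =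
      ⟨some exit, (some a, v), joinStacks (pushAll a ks s) S⟩ := by
  induction ks generalizing s with
  | nil => simp [pushCode]
  | cons k ks ih =>
    simp only [pushCode, Turing.TM2.stepAux, pushAll_cons]
    rw [← ih]
    exact congrArg _ (update_joinStacks_inl s S k (a :: s k))

/-- One step of a `TM2` machine executes a whole statement up to its `goto`, so each unit of time in
`Runs` is one machine step. Embedding and exit label are arbitrary because a subprogram continues
inside the larger one: the first part of a `seq` exits to the second, and the body of a loop exits
to its test. The register ends with the last symbol read, hence the existential. -/
theorem Runs.reachesIn [Inhabited Γ] {P : StackProg K Γ} {s s' : K → List Γ} {t : ℕ}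
    (h : P.Runs s s' t) (m : Λ → Turing.TM2.Stmt (JoinAlphabet K Γ Γ') Λ (Option Γ × σ))
    (emb : P.Label → Λ) (exit : Λ) (hm : ∀ l, m (emb l) = P.code emb exit l) (r : Option Γ) (v : σ)
    (S : ∀ k, List (Γ' k)) :
    ∃ r', ReachesIn (Turing.TM2.step m) t ⟨some (emb P.entry), (r, v), joinStacks s S⟩
      ⟨some exit, (r', v), joinStacks s' S⟩ := by
  induction h generalizing exit r with
  | push k a s =>
    refine ⟨r, ReachesIn.single ?_⟩
    rw [Turing.TM2.step.eq_2, hm]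
    simp only [code, Turing.TM2.stepAux]
    exact congrArg _ (congrArg _ (update_joinStacks_inl s S k (a :: s k)))
  | @move k ks s a r' h =>
    refine ⟨some a, ReachesIn.single ?_⟩
    rw [Turing.TM2.step.eq_2, hm]
    refine congrArg some ((stepAux_pop_inl k _ r v s S).trans ?_)
    rw [h]
    exact stepAux_pushCode exit ks a v _ S
  | @seq P Q s s' s'' t t' hP hQ ihP ihQ =>
    obtain ⟨r₁, h₁⟩ := ihP (fun l => emb (.inl l)) (emb (.inr Q.entry)) (fun l => hm _) r
    obtain ⟨r₂, h₂⟩ := ihQ (fun l => emb (.inr l)) exit (fun l => hm _) r₁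
    exact ⟨r₂, h₁.trans h₂⟩
  | @ite_true k p P Q s s' t h hP ihP =>
    obtain ⟨r₁, h₁⟩ := ihP (fun l => emb (some (.inl l))) exit (fun l => hm _) (s k).head?
    refine ⟨r₁, ReachesIn.trans (ReachesIn.single ?_) h₁⟩
    rw [Turing.TM2.step.eq_2, hm]
    simp only [entry, code, Turing.TM2.stepAux]
    have e : (joinStacks s S (.inl k)).head? = (s k).head? := rfl
    rw [e, h]
    rfl
  | @ite_false k p P Q s s' t h hP ihP =>
    obtain ⟨r₁, h₁⟩ := ihP (fun l => emb (some (.inr l))) exit (fun l => hm _) (s k).head?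
    refine ⟨r₁, ReachesIn.trans (ReachesIn.single ?_) h₁⟩
    rw [Turing.TM2.step.eq_2, hm]
    simp only [entry, code, Turing.TM2.stepAux]
    have e : (joinStacks s S (.inl k)).head? = (s k).head? := rfl
    rw [e, h]
    rfl
  | @loop_true k p P s s' s'' t t' h hP hL ihP ihL =>
    obtain ⟨r₁, h₁⟩ := ihP (fun l => emb (some l)) (emb none) (fun l => hm _) (s k).head?
    obtain ⟨r₂, h₂⟩ := ihL emb exit hm r₁
    refine ⟨r₂, ReachesIn.trans (ReachesIn.trans (ReachesIn.single ?_) h₁) h₂⟩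
    rw [Turing.TM2.step.eq_2, hm]
    simp only [entry, code, Turing.TM2.stepAux]
    have e : (joinStacks s S (.inl k)).head? = (s k).head? := rfl
    rw [e, h]
    rfl
  | @loop_false k p P s h =>
    refine ⟨(s k).head?, ReachesIn.single ?_⟩
    rw [Turing.TM2.step.eq_2, hm]
    simp only [entry, code, Turing.TM2.stepAux]
    have e : (joinStacks s S (.inl k)).head? = (s k).head? := rfl
    rw [e, h]
    rfl

/-! ### Running a machine after a program -/

section Lift

variable {Λ' σ' : Type}

/-- A statement of a machine, as a statement of a machine with more stacks, labels and states. -/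
def liftStmt (emb : Λ' → Λ) :
    Turing.TM2.Stmt Γ' Λ' σ → Turing.TM2.Stmt (JoinAlphabet K Γ Γ') Λ (σ' × σ)
  | .push k f q => .push (.inr k) (fun v => f v.2) (liftStmt emb q)
  | .peek k f q => .peek (.inr k) (fun v a => (v.1, f v.2 a)) (liftStmt emb q)
  | .pop k f q => .pop (.inr k) (fun v a => (v.1, f v.2 a)) (liftStmt emb q)
  | .load f q => .load (fun v => (v.1, f v.2)) (liftStmt emb q)
  | .branch p q q' => .branch (fun v => p v.2) (liftStmt emb q) (liftStmt emb q')
  | .goto l => .goto fun v => emb (l v.2)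
  | .halt => .halt

/-- A configuration of a machine, as a configuration of a machine with more stacks, labels and
states. -/
def liftCfg (emb : Λ' → Λ) (r : σ') (s : K → List Γ) (c : Turing.TM2.Cfg Γ' Λ' σ) :
    Turing.TM2.Cfg (JoinAlphabet K Γ Γ') Λ (σ' × σ) :=
  ⟨c.l.map emb, (r, c.var), joinStacks s c.stk⟩

theorem stepAux_liftStmt (emb : Λ' → Λ) (q : Turing.TM2.Stmt Γ' Λ' σ) (r : σ') (v : σ)
    (s : K → List Γ) (S : ∀ k, List (Γ' k)) :
    Turing.TM2.stepAux (liftStmt emb q) (r, v) (joinStacks s S) =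
      liftCfg emb r s (Turing.TM2.stepAux q v S) := by
  induction q generalizing v S with
  | push k f q ih =>
    simp only [liftStmt, Turing.TM2.stepAux]
    rw [← ih]
    exact congrArg _ (update_joinStacks_inr s S k (f v :: S k))
  | peek k f q ih =>
    simp only [liftStmt, Turing.TM2.stepAux]
    rw [← ih]
    rfl
  | pop k f q ih =>
    simp only [liftStmt, Turing.TM2.stepAux]
    rw [← ih]
    exact congrArg _ (update_joinStacks_inr s S k (S k).tail)
  | load f q ih => simpa only [liftStmt, Turing.TM2.stepAux] using ih _ _
  | branch p q q' ih ih' =>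
    simp only [liftStmt, Turing.TM2.stepAux]
    cases p v
    · exact ih' _ _
    · exact ih _ _
  | goto l => rfl
  | halt => rfl

/-- The lifted statements neither read nor change the added stacks and the added state, so a run
lifts step by step. -/
theorem reachesIn_liftCfg (emb : Λ' → Λ) (m : Λ' → Turing.TM2.Stmt Γ' Λ' σ)
    (m' : Λ → Turing.TM2.Stmt (JoinAlphabet K Γ Γ') Λ (σ' × σ))
    (hm : ∀ l, m' (emb l) = liftStmt emb (m l)) (r : σ') (s : K → List Γ) {t : ℕ}
    {c c' : Turing.TM2.Cfg Γ' Λ' σ} (h : ReachesIn (Turing.TM2.step m) t c c') :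
    ReachesIn (Turing.TM2.step m') t (liftCfg emb r s c) (liftCfg emb r s c') := by
  induction t generalizing c' with
  | zero =>
    cases Option.some.inj (show some c = some c' from h)
    rfl
  | succ t ih =>
    unfold ReachesIn at h
    rw [Function.iterate_succ_apply'] at h
    obtain ⟨c₁, h₁, h₂⟩ := Option.bind_eq_some_iff.mp h
    refine (ih h₁).trans (ReachesIn.single ?_)
    obtain ⟨_ | l, v, S⟩ := c₁
    · simp at h₂
    · rw [Turing.TM2.step.eq_2] at h₂
      cases Option.some.inj h₂
      change Turing.TM2.step m' ⟨some (emb l), (r, v), joinStacks s S⟩ = _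
      rw [Turing.TM2.step.eq_2, hm, stepAux_liftStmt]

end Lift

/-! ### Running a program and then a decision machine on its output -/

variable {Δ : Type}

/-- The labels of the machine that runs a program, then transfers the contents of its output stack,
then runs another machine. -/
abbrev ThenLabel (P : StackProg K Γ) (M : DecisionTM Δ) : Type := P.Label ⊕ Unit ⊕ M.tm.Λ

/-- The code of the machine that runs the program `P`, then moves the contents of the stack `out`,
translated by `d`, to the input stack of `M`, then runs `M`. -/
def thenCode [Inhabited Γ] (P : StackProg K Γ) (out : K) (d : Γ → Δ) (M : DecisionTM Δ) :
    P.ThenLabel M →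
      Turing.TM2.Stmt (JoinAlphabet K Γ M.tm.Γ) (P.ThenLabel M) (Option Γ × M.tm.σ)
  | .inl l => P.code Sum.inl (.inr (.inl ())) l
  | .inr (.inl _) => .pop (.inl out) (fun v a => (a, v.2)) (.branch (fun v => v.1.isSome)
      (.push (.inr M.tm.k₀) (fun v => M.inputAlphabet.symm (d (v.1.getD default)))
        (.goto fun _ => .inr (.inl ())))
      (.goto fun _ => .inr (.inr M.tm.main)))
  | .inr (.inr l) => liftStmt (fun l => .inr (.inr l)) (M.tm.m l)

/-- Each symbol costs one step, and one more step finds the stack empty. Moving symbols between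
stacks reverses the word, which is why programs leave their output reversed. -/
theorem reachesIn_transfer [Inhabited Γ] (P : StackProg K Γ) (out : K) (d : Γ → Δ)
    (M : DecisionTM Δ) (r : Option Γ) (v : M.tm.σ) (s : K → List Γ) (S : ∀ k, List (M.tm.Γ k))
    (w : List Γ) (hw : s out = w) :
    ReachesIn (Turing.TM2.step (P.thenCode out d M)) (w.length + 1)
      ⟨some (.inr (.inl ())), (r, v), joinStacks s S⟩
      ⟨some (.inr (.inr M.tm.main)), (none, v), joinStacks (Function.update s out [])
        (Function.update S M.tm.k₀
          ((w.reverse.map d).map M.inputAlphabet.symm ++ S M.tm.k₀))⟩ := by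
  induction w generalizing r s S with
  | nil =>
    refine ReachesIn.single ?_
    rw [Turing.TM2.step.eq_2]
    refine congrArg some ((stepAux_pop_inl out _ r v s S).trans ?_)
    rw [hw]
    simp [Turing.TM2.stepAux]
  | cons a w ih =>
    have h := ih (some a) (Function.update s out w)
      (Function.update S M.tm.k₀ (M.inputAlphabet.symm (d a) :: S M.tm.k₀)) (by simp)
    have h₁ : ReachesIn (Turing.TM2.step (P.thenCode out d M)) 1
        ⟨some (.inr (.inl ())), (r, v), joinStacks s S⟩
        ⟨some (.inr (.inl ())), (some a, v), joinStacks (Function.update s out w)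
          (Function.update S M.tm.k₀ (M.inputAlphabet.symm (d a) :: S M.tm.k₀))⟩ := by
      refine ReachesIn.single ?_
      rw [Turing.TM2.step.eq_2]
      refine congrArg some ((stepAux_pop_inl out _ r v s S).trans ?_)
      rw [hw, ← update_joinStacks_inr]
      rfl
    have h₂ := h₁.trans h
    simpa [add_comm, add_left_comm] using h₂

/-- Run a program that prepares an input for the machine `M`, then run `M`. -/
noncomputable def thenTM [Fintype K] [Fintype Γ] [Inhabited Γ] (P : StackProg K Γ) (inp out : K)
    (d : Γ → Δ) (M : DecisionTM Δ) : DecisionTM Γ where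
  tm :=
    { K := K ⊕ M.tm.K
      kDecidableEq := inferInstance
      kFin := letI := M.tm.kFin; inferInstance
      k₀ := .inl inp
      -- The output stack is irrelevant: the answer is read from the internal state.
      k₁ := .inl inp
      Γ := JoinAlphabet K Γ M.tm.Γ
      Λ := P.ThenLabel M
      main := .inl P.entry
      ΛFin := letI := M.tm.ΛFin; letI := Fintype.ofFinite P.Label; inferInstance
      σ := Option Γ × M.tm.σ
      initialState := (none, M.tm.initialState)
      σFin := letI := M.tm.σFin; inferInstance
      Γk₀Fin := inferInstanceAs (Fintype Γ)
      m := P.thenCode out d M }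
  finiteAlphabet := by
    rintro (k | k)
    · exact inferInstanceAs (Finite Γ)
    · exact M.finiteAlphabet k
  inputAlphabet := Equiv.refl Γ
  accept v := M.accept v.2

theorem initList_stk (tm : Turing.FinTM2) (w : List (tm.Γ tm.k₀)) :
    (Turing.initList tm w).stk = Function.update (fun _ => []) tm.k₀ w := by
  funext k
  by_cases h : k = tm.k₀
  · subst h
    simp [Turing.initList]
  · simp [Turing.initList, h]

/-- Three runs are concatenated: the compiled program, the transfer of its output, and the lifted
run of `M`. -/
theorem Runs.answersWithin [Fintype K] [Fintype Γ] [Inhabited Γ] {P : StackProg K Γ} {inp out : K}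
    {d : Γ → Δ} {M : DecisionTM Δ} {w : List Γ} {s : K → List Γ} {t t' : ℕ} {p : Prop}
    (h : P.Runs (Function.update (fun _ => []) inp w) s t)
    (hM : M.AnswersWithin ((s out).reverse.map d) p t') :
    (P.thenTM inp out d M).AnswersWithin w p (t + ((s out).length + 1) + t') := by
  obtain ⟨cfg, hl, hp, ⟨⟨⟨steps, hev⟩, hle⟩⟩⟩ := hM
  refine ⟨liftCfg (fun l => .inr (.inr l)) none (Function.update s out []) cfg, ?_, hp,
    ⟨⟨⟨t + ((s out).length + 1) + steps, ?_⟩, by dsimp only at hle ⊢; omega⟩⟩⟩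
  · change cfg.l.map _ = none
    rw [hl]
    rfl
  · obtain ⟨r, h₁⟩ := h.reachesIn (P.thenCode out d M) Sum.inl (.inr (.inl ())) (fun l => rfl) none
      M.tm.initialState (fun _ => [])
    have h₂ := reachesIn_transfer P out d M r M.tm.initialState s (fun _ => []) _ rfl
    have h₃ : ReachesIn (Turing.TM2.step (P.thenCode out d M)) steps _ _ :=
      reachesIn_liftCfg (fun l => .inr (.inr l)) M.tm.m (P.thenCode out d M) (fun l => rfl) none
        (Function.update s out []) (show ReachesIn (Turing.TM2.step M.tm.m) steps _ _ from hev)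
    -- After the transfer, the part of the configuration that `M` sees is its initial configuration;
    -- what the program left on its other stacks is invisible to `M`.
    have e₁ : liftCfg (fun l => (.inr (.inr l) : P.ThenLabel M)) (none : Option Γ)
        (Function.update s out []) (Turing.initList M.tm
          (((s out).reverse.map d).map M.inputAlphabet.symm)) =
        ⟨some (.inr (.inr M.tm.main)), (none, M.tm.initialState),
          joinStacks (Function.update s out []) (Function.update (fun _ => []) M.tm.k₀
          (((s out).reverse.map d).map M.inputAlphabet.symm ++ []))⟩ := by
      unfold liftCfg
      rw [initList_stk]
      simp [Turing.initList]
    rw [e₁] at h₃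
    have h₄ := (h₁.trans h₂).trans h₃
    have e₂ : Turing.initList (P.thenTM inp out d M).tm
        (w.map (P.thenTM inp out d M).inputAlphabet.symm) =
        ⟨some (.inl P.entry), (none, M.tm.initialState),
          joinStacks (Function.update (fun _ => []) inp w) (fun _ => [])⟩ := by
      have := initList_stk (P.thenTM inp out d M).tm
        (w.map (P.thenTM inp out d M).inputAlphabet.symm)
      have e : w.map (P.thenTM inp out d M).inputAlphabet.symm = w := List.map_id _
      rw [← update_joinStacks_inl]
      rw [e] at this ⊢
      refine congrArg (fun S => (⟨some (.inl P.entry), (none, M.tm.initialState), S⟩ :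
        Turing.TM2.Cfg (JoinAlphabet K Γ M.tm.Γ) (P.ThenLabel M) (Option Γ × M.tm.σ)))
        (this.trans ?_)
      have e₀ : (fun _ => [] : ∀ k, List (JoinAlphabet K Γ M.tm.Γ k)) =
          joinStacks (fun _ => []) (fun _ => []) := by
        funext k
        rcases k with k | k <;> rfl
      rw [← e₀]
      rfl
    rw [e₂]
    exact h₄

end StackProg

namespace StackProg

/-! ### Time bounds for structured programs -/

theorem foldl_cons_eq {Γ : Type} (l l' : List Γ) :
    l.foldl (fun b a => a :: b) l' = l.reverse ++ l' := by
  induction l generalizing l' <;> simp_all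

section TimeBounds

variable {K Γ : Type} [DecidableEq K] {P Q : StackProg K Γ} {s s' s'' : K → List Γ} {T T' : ℕ}

/-- `RunsIn P s s' T`: started with the stacks `s`, the program `P` ends with the stacks `s'` after
at most `T` steps. -/
def RunsIn (P : StackProg K Γ) (s s' : K → List Γ) (T : ℕ) : Prop :=
  ∃ t ≤ T, P.Runs s s' t

theorem RunsIn.mono (h : P.RunsIn s s' T) (hT : T ≤ T') : P.RunsIn s s' T' :=
  let ⟨t, ht, hP⟩ := h
  ⟨t, ht.trans hT, hP⟩

theorem RunsIn.seq (hP : P.RunsIn s s' T) (hQ : Q.RunsIn s' s'' T') :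
    (P.seq Q).RunsIn s s'' (T + T') :=
  let ⟨t, ht, hP⟩ := hP
  let ⟨t', ht', hQ⟩ := hQ
  ⟨t + t', add_le_add ht ht', hP.seq hQ⟩

theorem RunsIn.push (k : K) (a : Γ) (s : K → List Γ) :
    (StackProg.push k a).RunsIn s (Function.update s k (a :: s k)) 1 :=
  ⟨1, le_rfl, .push k a s⟩

theorem RunsIn.move {k : K} (ks : List K) {a : Γ} {r : List Γ} (h : s k = a :: r) :
    (StackProg.move k ks).RunsIn s (pushAll a ks (Function.update s k r)) 1 :=
  ⟨1, le_rfl, .move h⟩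

theorem RunsIn.push_seq {k : K} {a : Γ} (h : Q.RunsIn (Function.update s k (a :: s k)) s' T) :
    ((StackProg.push k a).seq Q).RunsIn s s' (1 + T) :=
  (RunsIn.push k a s).seq h

theorem RunsIn.move_seq {k : K} {ks : List K} {a : Γ} {r : List Γ} (hk : s k = a :: r)
    (h : Q.RunsIn (pushAll a ks (Function.update s k r)) s' T) :
    ((StackProg.move k ks).seq Q).RunsIn s s' (1 + T) :=
  (RunsIn.move ks hk).seq h

theorem RunsIn.ite_true {k : K} {p : Option Γ → Bool} (h : p (s k).head? = true)
    (hP : P.RunsIn s s' T) : (StackProg.ite k p P Q).RunsIn s s' (1 + T) :=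
  let ⟨t, ht, hP⟩ := hP
  ⟨1 + t, by omega, .ite_true h hP⟩

theorem RunsIn.ite_false {k : K} {p : Option Γ → Bool} (h : p (s k).head? = false)
    (hQ : Q.RunsIn s s' T) : (StackProg.ite k p P Q).RunsIn s s' (1 + T) :=
  let ⟨t, ht, hQ⟩ := hQ
  ⟨1 + t, by omega, .ite_false h hQ⟩

theorem RunsIn.loop_true {k : K} {p : Option Γ → Bool} (h : p (s k).head? = true)
    (hP : P.RunsIn s s' T) (hL : (StackProg.loop k p P).RunsIn s' s'' T') :
    (StackProg.loop k p P).RunsIn s s'' (1 + T + T') :=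
  let ⟨t, ht, hP⟩ := hP
  let ⟨t', ht', hL⟩ := hL
  ⟨1 + t + t', by omega, .loop_true h hP hL⟩

theorem RunsIn.loop_false {k : K} {p : Option Γ → Bool} (h : p (s k).head? = false) :
    (StackProg.loop k p P).RunsIn s s 1 :=
  ⟨1, le_rfl, .loop_false h⟩

/-- A loop whose states are indexed by the number of iterations done. -/
theorem RunsIn.loop_nat {k : K} {p : Option Γ → Bool} (f : ℕ → K → List Γ) (N : ℕ)
    (hp : ∀ i < N, p (f i k).head? = true) (hN : p (f N k).head? = false)
    (hP : ∀ i < N, P.RunsIn (f i) (f (i + 1)) T) :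
    (StackProg.loop k p P).RunsIn (f 0) (f N) (N * (T + 1) + 1) := by
  induction N generalizing f with
  | zero => simpa using RunsIn.loop_false hN
  | succ N ih =>
    refine ((hP 0 (by omega)).loop_true (hp 0 (by omega)) (ih (fun i => f (i + 1))
      (fun i hi => hp _ (by omega)) hN (fun i hi => hP _ (by omega)))).mono (le_of_eq ?_)
    ring

/-- A loop that consumes a list and accumulates a result. -/
theorem RunsIn.loop_foldl {α β : Type*} {k : K} {p : Option Γ → Bool} (f : List α → β → K → List Γ)
    (g : β → α → β) (hp : ∀ a l b, p (f (a :: l) b k).head? = true)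
    (hN : ∀ b, p (f [] b k).head? = false) (l : List α) (b : β)
    (hP : ∀ a ∈ l, ∀ l' b, P.RunsIn (f (a :: l') b) (f l' (g b a)) T) :
    (StackProg.loop k p P).RunsIn (f l b) (f [] (l.foldl g b)) (l.length * (T + 1) + 1) := by
  induction l generalizing b with
  | nil => simpa using RunsIn.loop_false (hN b)
  | cons a l ih =>
    refine ((hP a (by simp) l b).loop_true (hp a l b)
      (ih (g b a) (fun a ha => hP a (by simp [ha])))).mono (le_of_eq ?_)
    simp only [List.length_cons]
    ring

/-- Move the contents of a stack, symbol by symbol, to each stack of a list. -/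
def drain (k : K) (ks : List K) : StackProg K Γ :=
  .loop k Option.isSome (.move k ks)

/-- Each symbol costs a test and a move, and a last test ends the loop. -/
theorem RunsIn.clear (k : K) (s : K → List Γ) :
    (drain k []).RunsIn s (Function.update s k []) (2 * (s k).length + 1) := by
  have h := RunsIn.loop_foldl (P := .move k []) (T := 1) (k := k) (p := Option.isSome)
    (fun l (_ : Unit) => Function.update s k l) (fun b _ => b) (by simp) (by simp) (s k) ()
    (fun a _ l' b => by
      have := RunsIn.move (s := Function.update s k (a :: l')) (k := k)
        (a := a) (r := l') [] (by simp)
      simpa using this)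
  simp only [Function.update_eq_self] at h
  exact h.mono (by omega)

/-- Draining reverses, so copying in the same order takes two drains. -/
theorem RunsIn.drain_one {k k₁ : K} (h₁ : k₁ ≠ k) (s : K → List Γ) :
    (drain k [k₁]).RunsIn s
      (Function.update (Function.update s k []) k₁ ((s k).reverse ++ s k₁))
      (2 * (s k).length + 1) := by
  have h := RunsIn.loop_foldl (P := .move k [k₁]) (T := 1) (k := k) (p := Option.isSome)
    (fun l b => Function.update (Function.update s k l) k₁ b) (fun b a => a :: b)
    (by simp [h₁.symm]) (by simp [h₁.symm]) (s k) (s k₁)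
    (fun a _ l' b => by
      have := RunsIn.move (s := Function.update (Function.update s k (a :: l')) k₁ b) (k := k)
        (a := a) (r := l') [k₁] (by simp [h₁.symm])
      simp only [pushAll_cons, pushAll_nil] at this
      rw [Function.update_comm h₁] at this
      simpa [h₁] using this)
  rw [foldl_cons_eq, Function.update_eq_self] at h
  have e : Function.update s k₁ (s k₁) = s := Function.update_eq_self _ _
  rw [e] at h
  exact h.mono (by omega)

theorem RunsIn.drain_two {k k₁ k₂ : K} (h₁ : k₁ ≠ k) (h₂ : k₂ ≠ k) (h₁₂ : k₁ ≠ k₂)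
    (s : K → List Γ) :
    (drain k [k₁, k₂]).RunsIn s
      (Function.update (Function.update (Function.update s k []) k₁ ((s k).reverse ++ s k₁))
        k₂ ((s k).reverse ++ s k₂))
      (2 * (s k).length + 1) := by
  let f : List Γ → List Γ × List Γ → K → List Γ := fun l b =>
    Function.update (Function.update (Function.update s k l) k₁ b.1) k₂ b.2
  have h := RunsIn.loop_foldl (P := .move k [k₁, k₂]) (T := 1) (k := k) (p := Option.isSome)
    f (fun b a => (a :: b.1, a :: b.2))
    (by simp [f, h₁.symm, h₂.symm]) (by simp [f, h₁.symm, h₂.symm]) (s k) (s k₁, s k₂)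
    (fun a _ l' b => by
      have := RunsIn.move (s := f (a :: l') b) (k := k)
        (a := a) (r := l') [k₁, k₂] (by simp [f, h₁.symm, h₂.symm])
      convert this using 1
      funext i
      by_cases i₁ : i = k₁ <;> by_cases i₂ : i = k₂ <;> by_cases i₀ : i = k <;>
        simp_all [f, Function.update_apply])
  have e : ∀ (l : List Γ) (b : List Γ × List Γ),
      l.foldl (fun b a => (a :: b.1, a :: b.2)) b = (l.reverse ++ b.1, l.reverse ++ b.2) := by
    intro l
    induction l <;> simp_all
  rw [e] at h
  have e₀ : f (s k) (s k₁, s k₂) = s := by simp [f]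
  rw [e₀] at h
  exact h.mono (by omega)

end TimeBounds

/-! ### Loops over unary counters -/

section Counters

variable {K : Type} [DecidableEq K] {P : StackProg K Symbol} {T : ℕ}

/-- A stack that holds the number `n` in unary. -/
abbrev unary (n : ℕ) : List Symbol := List.replicate n Symbol.tally

/-- Run a program once for each symbol on the stack `c`, which is restored by means of `t`. -/
def forEach (c t : K) (P : StackProg K Symbol) : StackProg K Symbol :=
  (StackProg.loop c Option.isSome ((StackProg.move c [t]).seq P)).seq (drain t [c])

theorem head?_unary_isSome (n : ℕ) : (unary n).head?.isSome = decide (0 < n) := by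
  cases n <;> simp [unary, List.replicate_succ]

/-- During the loop the `N` tallies are split between `c` and `t`, so the body has to work for
arbitrary contents of these two stacks. The loop takes `N (T + 2) + 1` steps, and the drain that
restores `c` takes `2 N + 1`. -/
theorem RunsIn.forEach {c t : K} (hct : c ≠ t) (N : ℕ) (f : ℕ → K → List Symbol)
    (h₀ : f 0 c = unary N) (h₀' : f 0 t = []) (hN : f N c = unary N) (hN' : f N t = [])
    (hP : ∀ i < N, ∀ x y, P.RunsIn (Function.update (Function.update (f i) c x) t y)
      (Function.update (Function.update (f (i + 1)) c x) t y) T) :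
    (forEach c t P).RunsIn (f 0) (f N) (N * (T + 4) + 2) := by
  let g : ℕ → K → List Symbol := fun i =>
    Function.update (Function.update (f i) c (unary (N - i))) t (unary i)
  have h₁ : (StackProg.loop c Option.isSome ((StackProg.move c [t]).seq P)).RunsIn (g 0) (g N)
      (N * (1 + T + 1) + 1) := by
    refine RunsIn.loop_nat g N (fun i hi => ?_) ?_ (fun i hi => ?_)
    · simp [g, hct, head?_unary_isSome, hi]
    · simp [g, hct]
    · have hi' : N - i = (N - (i + 1)) + 1 := by omega
      refine RunsIn.move_seq (a := .tally) (r := unary (N - (i + 1))) ?_ ?_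
      · simp only [g, Function.update_of_ne hct, Function.update_self]
        rw [hi', unary, List.replicate_succ]
      · convert hP i hi (unary (N - (i + 1))) (unary (i + 1)) using 1
        funext j
        by_cases j₁ : j = c <;> by_cases j₂ : j = t <;>
          simp_all [g, Function.update_apply, List.replicate_succ]
  have e₀ : g 0 = f 0 := by
    simp only [g, Nat.sub_zero, ← h₀, Function.update_eq_self]
    simp [unary, ← h₀']
  rw [e₀] at h₁
  have h₂ : (StackProg.forEach c t P).RunsIn (f 0) _ (N * (T + 4) + 2) :=
    (h₁.seq (RunsIn.drain_one hct (g N))).mono (by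
      simp only [g, Function.update_self, List.length_replicate]
      apply le_of_eq
      ring)
  · convert h₂ using 1
    funext j
    by_cases j₁ : j = c <;> by_cases j₂ : j = t <;>
      simp_all [g]

/-- Push a symbol onto the stack `k` once for each symbol on the stack `c`, which is restored by
means of `t`. -/
def fill (c t k : K) (a : Symbol) : StackProg K Symbol :=
  forEach c t (.push k a)

theorem RunsIn.fill {c t k : K} (hct : c ≠ t) (hk : k ≠ c) (hk' : k ≠ t) (a : Symbol) (N : ℕ)
    (s : K → List Symbol) (h₀ : s c = unary N) (h₀' : s t = []) :
    (fill c t k a).RunsIn s (Function.update s k (List.replicate N a ++ s k)) (N * 5 + 2) := by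
  have h := RunsIn.forEach (P := .push k a) (T := 1) hct N
    (fun i => Function.update s k (List.replicate i a ++ s k))
    (by simp [hk.symm, h₀]) (by simp [hk'.symm, h₀'])
    (by simp [hk.symm, h₀]) (by simp [hk'.symm, h₀'])
    (fun i hi x y => by
      have := RunsIn.push k a (Function.update (Function.update
        (Function.update s k (List.replicate i a ++ s k)) c x) t y)
      convert this using 1
      funext j
      by_cases j₁ : j = c <;> by_cases j₂ : j = t <;> by_cases j₃ : j = k <;>
        simp_all [List.replicate_succ])
  simpa [StackProg.fill] using h

end Counters

end StackProg

/-- The stacks of the program that reduces 3-SAT to Minimum Membership Dominating Set. -/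
inductive ReductionStack
  /-- the formula -/
  | inp
  /-- the number `D` of literal vertices -/
  | dim
  /-- a counter -/
  | pre
  /-- a counter -/
  | ctr
  /-- scratch space for counters -/
  | tmp
  /-- the row under construction -/
  | vec
  /-- scratch space for the row under construction -/
  | aux
  /-- the finished rows -/
  | rows
  /-- scratch space for the finished rows -/
  | rest
  /-- the number of finished rows -/
  | cnt
  /-- the result, reversed -/
  | out
  deriving DecidableEq

instance : Fintype ReductionStack :=
  ⟨⟨Multiset.ofList [.inp, .dim, .pre, .ctr, .tmp, .vec, .aux, .rows, .rest, .cnt, .out],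
    by simp⟩, by rintro ⟨⟩ <;> simp⟩

namespace ThreeCNF

instance : Inhabited Symbol := ⟨.tally⟩

instance : Fintype Symbol :=
  ⟨⟨Multiset.ofList [.tally, .pos, .neg, .sep], by simp⟩, by rintro (_ | _ | _ | _) <;> simp⟩

end ThreeCNF

namespace StackProg

/-! ### The program that carries out the reduction -/

/-- The contents of all stacks. -/
def contents (inp dim pre ctr tmp vec aux rows rest cnt out : List Symbol) :
    ReductionStack → List Symbol
  | .inp => inp
  | .dim => dim
  | .pre => pre
  | .ctr => ctr
  | .tmp => tmp
  | .vec => vec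
  | .aux => aux
  | .rows => rows
  | .rest => rest
  | .cnt => cnt
  | .out => out

/-! ### Access to the named stacks -/

section Stacks

variable (inp dim pre ctr tmp vec aux rows rest cnt out x : List Symbol)

@[simp] theorem contents_inp : contents inp dim pre ctr tmp vec aux rows rest cnt out .inp = inp := rfl

@[simp] theorem contents_dim : contents inp dim pre ctr tmp vec aux rows rest cnt out .dim = dim := rfl

@[simp] theorem contents_pre : contents inp dim pre ctr tmp vec aux rows rest cnt out .pre = pre := rfl

@[simp] theorem contents_ctr : contents inp dim pre ctr tmp vec aux rows rest cnt out .ctr = ctr := rfl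

@[simp] theorem contents_tmp : contents inp dim pre ctr tmp vec aux rows rest cnt out .tmp = tmp := rfl

@[simp] theorem contents_vec : contents inp dim pre ctr tmp vec aux rows rest cnt out .vec = vec := rfl

@[simp] theorem contents_aux : contents inp dim pre ctr tmp vec aux rows rest cnt out .aux = aux := rfl

@[simp] theorem contents_rows : contents inp dim pre ctr tmp vec aux rows rest cnt out .rows = rows := rfl

@[simp] theorem contents_rest : contents inp dim pre ctr tmp vec aux rows rest cnt out .rest = rest := rfl

@[simp] theorem contents_cnt : contents inp dim pre ctr tmp vec aux rows rest cnt out .cnt = cnt := rfl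

@[simp] theorem contents_out : contents inp dim pre ctr tmp vec aux rows rest cnt out .out = out := rfl

@[simp] theorem update_contents_inp :
    Function.update (contents inp dim pre ctr tmp vec aux rows rest cnt out) .inp x =
      contents x dim pre ctr tmp vec aux rows rest cnt out := by
  funext k; cases k <;> rfl

@[simp] theorem update_contents_dim :
    Function.update (contents inp dim pre ctr tmp vec aux rows rest cnt out) .dim x =
      contents inp x pre ctr tmp vec aux rows rest cnt out := by
  funext k; cases k <;> rfl

@[simp] theorem update_contents_pre :
    Function.update (contents inp dim pre ctr tmp vec aux rows rest cnt out) .pre x =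
      contents inp dim x ctr tmp vec aux rows rest cnt out := by
  funext k; cases k <;> rfl

@[simp] theorem update_contents_ctr :
    Function.update (contents inp dim pre ctr tmp vec aux rows rest cnt out) .ctr x =
      contents inp dim pre x tmp vec aux rows rest cnt out := by
  funext k; cases k <;> rfl

@[simp] theorem update_contents_tmp :
    Function.update (contents inp dim pre ctr tmp vec aux rows rest cnt out) .tmp x =
      contents inp dim pre ctr x vec aux rows rest cnt out := by
  funext k; cases k <;> rfl

@[simp] theorem update_contents_vec :
    Function.update (contents inp dim pre ctr tmp vec aux rows rest cnt out) .vec x =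
      contents inp dim pre ctr tmp x aux rows rest cnt out := by
  funext k; cases k <;> rfl

@[simp] theorem update_contents_aux :
    Function.update (contents inp dim pre ctr tmp vec aux rows rest cnt out) .aux x =
      contents inp dim pre ctr tmp vec x rows rest cnt out := by
  funext k; cases k <;> rfl

@[simp] theorem update_contents_rows :
    Function.update (contents inp dim pre ctr tmp vec aux rows rest cnt out) .rows x =
      contents inp dim pre ctr tmp vec aux x rest cnt out := by
  funext k; cases k <;> rfl

@[simp] theorem update_contents_rest :
    Function.update (contents inp dim pre ctr tmp vec aux rows rest cnt out) .rest x =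
      contents inp dim pre ctr tmp vec aux rows x cnt out := by
  funext k; cases k <;> rfl

@[simp] theorem update_contents_cnt :
    Function.update (contents inp dim pre ctr tmp vec aux rows rest cnt out) .cnt x =
      contents inp dim pre ctr tmp vec aux rows rest x out := by
  funext k; cases k <;> rfl

@[simp] theorem update_contents_out :
    Function.update (contents inp dim pre ctr tmp vec aux rows rest cnt out) .out x =
      contents inp dim pre ctr tmp vec aux rows rest cnt x := by
  funext k; cases k <;> rfl

end Stacks

/-- The top symbol is a tally. -/
def isTally : Option Symbol → Bool
  | some .tally => true
  | _ => false

/-- The top symbol is a separator. -/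
def isSep : Option Symbol → Bool
  | some .sep => true
  | _ => false

/-- The top symbol is a positive sign. -/
def isPos : Option Symbol → Bool
  | some .pos => true
  | _ => false

/-- There is a top symbol, and it is not a separator. -/
def isNotSep : Option Symbol → Bool
  | some .sep => false
  | none => false
  | _ => true

/-- A bit vector, written with signs. -/
def bits (v : List Bool) : List Symbol :=
  v.map fun b => if b then Symbol.pos else Symbol.neg

/-- A list of bit vectors, each of them closed by a separator. -/
def encodeRows (R : List (List Bool)) : List Symbol :=
  R.flatMap fun v => bits v ++ [.sep]

@[simp] theorem bits_nil : bits [] = [] := rfl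

@[simp] theorem bits_cons (b : Bool) (v : List Bool) :
    bits (b :: v) = (if b then Symbol.pos else Symbol.neg) :: bits v := rfl

@[simp] theorem bits_append (v w : List Bool) : bits (v ++ w) = bits v ++ bits w := by
  simp [bits]

@[simp] theorem length_bits (v : List Bool) : (bits v).length = v.length := by simp [bits]

@[simp] theorem bits_replicate_true (n : ℕ) :
    bits (List.replicate n true) = List.replicate n .pos := by simp [bits]

@[simp] theorem bits_replicate_false (n : ℕ) :
    bits (List.replicate n false) = List.replicate n .neg := by simp [bits]

@[simp] theorem encodeRows_nil : encodeRows [] = [] := rfl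

@[simp] theorem encodeRows_cons (v : List Bool) (R : List (List Bool)) :
    encodeRows (v :: R) = bits v ++ .sep :: encodeRows R := by
  simp [encodeRows]

/-- Add the row under construction to the finished rows. -/
def storeRow : StackProg ReductionStack Symbol :=
  .seq (.push .rows .sep) (.seq (drain .vec [.aux]) (.seq (drain .aux [.vec, .rows])
    (.push .cnt .tally)))

/-- Add as many copies of the row under construction as there are literal vertices to the finished
rows. -/
def storeRows : StackProg ReductionStack Symbol :=
  forEach .dim .tmp storeRow

/-- Two drains cancel their reversals, and the second one also copies the row. The separator is
pushed first because it closes the row, so it lies below the bits. -/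
theorem runsIn_storeRow (inp dim pre ctr tmp rest out : List Symbol) (v : List Bool)
    (R : List (List Bool)) :
    storeRow.RunsIn
      (contents inp dim pre ctr tmp (bits v) [] (encodeRows R) rest (unary R.length) out)
      (contents inp dim pre ctr tmp (bits v) [] (encodeRows (v :: R)) rest (unary (v :: R).length)
        out)
      (4 * v.length + 4) := by
  have h := RunsIn.push_seq (k := .rows) (a := Symbol.sep)
    (s := contents inp dim pre ctr tmp (bits v) [] (encodeRows R) rest (unary R.length) out)
    ((RunsIn.drain_one (k := .vec) (k₁ := .aux) (by decide) _).seq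
      ((RunsIn.drain_two (k := .aux) (k₁ := .vec) (k₂ := .rows) (by decide) (by decide)
        (by decide) _).seq (RunsIn.push .cnt .tally _)))
  simp only [contents_rows, contents_vec, contents_aux, contents_cnt, update_contents_rows,
    update_contents_vec, update_contents_aux, update_contents_cnt, List.append_nil,
    List.length_reverse, List.reverse_reverse, length_bits] at h
  simpa only [storeRow, encodeRows_cons, List.length_cons, unary, List.replicate_succ] using
    h.mono (by omega)

theorem runsIn_storeRows (inp pre ctr rest out : List Symbol) {D : ℕ} {v : List Bool}
    (hv : v.length = D) (R : List (List Bool)) :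
    storeRows.RunsIn
      (contents inp (unary D) pre ctr [] (bits v) [] (encodeRows R) rest (unary R.length) out)
      (contents inp (unary D) pre ctr [] (bits v) [] (encodeRows (List.replicate D v ++ R)) rest
        (unary (List.replicate D v ++ R).length) out)
      (D * (4 * D + 8) + 2) := by
  refine (RunsIn.forEach (T := 4 * D + 4) (by decide) D (fun i => contents inp (unary D) pre ctr []
    (bits v) [] (encodeRows (List.replicate i v ++ R)) rest
    (unary (List.replicate i v ++ R).length) out) rfl rfl rfl rfl ?_).mono le_rfl
  intro i hi x y
  simp only [update_contents_dim, update_contents_tmp]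
  have := runsIn_storeRow inp x pre ctr y rest out v (List.replicate i v ++ R)
  rw [hv] at this
  exact this

end StackProg

/-! ### The header and the rows that do not depend on the clauses -/

namespace StackProg

/-- Push the numbers of a list onto the finished rows, each of them `D` times. -/
def stackRows (D : ℕ) (base R : List (List Bool)) : List (List Bool) :=
  base.foldl (fun R v => List.replicate D v ++ R) R

@[simp] theorem stackRows_nil (D : ℕ) (R : List (List Bool)) : stackRows D [] R = R := rfl

@[simp] theorem stackRows_cons (D : ℕ) (v : List Bool) (base R : List (List Bool)) :
    stackRows D (v :: base) R = stackRows D base (List.replicate D v ++ R) := rfl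

theorem stackRows_append (D : ℕ) (base base' R : List (List Bool)) :
    stackRows D (base ++ base') R = stackRows D base' (stackRows D base R) :=
  List.foldl_append

/-- Read the number of variables in unary, and set up the counters. -/
def readHeader : StackProg ReductionStack Symbol :=
  .seq (.loop .inp isTally (.seq (.move .inp []) (.seq (.push .dim .tally)
    (.seq (.push .dim .tally) (.seq (.push .ctr .tally) (.push .ctr .tally))))))
  (.seq (.move .inp []) (.seq (.push .dim .tally) (.seq (.push .dim .tally)
    (.seq (.push .dim .tally) (.seq (.push .dim .tally)
    (.seq (.push .ctr .tally) (.seq (.push .ctr .tally)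
    (.seq (.push .ctr .tally) (.push .ctr .tally)))))))))

theorem unary_succ (n : ℕ) : unary (n + 1) = .tally :: unary n := List.replicate_succ

/-- Every variable contributes a pair of positions, and the four tallies at the end account for the
two auxiliary pairs. The copy on `ctr` is the countdown for `storePairs`. -/
theorem runsIn_readHeader (n : ℕ) (w : List Symbol) :
    readHeader.RunsIn (contents (unary n ++ .sep :: w) [] [] [] [] [] [] [] [] [] [])
      (contents w (unary (2 * n + 4)) [] (unary (2 * n + 4)) [] [] [] [] [] [] [])
      (6 * n + 10) := by
  have h := RunsIn.loop_nat (k := .inp) (p := isTally) (T := 5)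
    (P := .seq (.move .inp []) (.seq (.push .dim .tally)
      (.seq (.push .dim .tally) (.seq (.push .ctr .tally) (.push .ctr .tally)))))
    (fun i => contents (unary (n - i) ++ .sep :: w) (unary (2 * i)) [] (unary (2 * i))
      [] [] [] [] [] [] []) n
    (fun i hi => by
      obtain ⟨j, hj⟩ : ∃ j, n - i = j + 1 := ⟨n - i - 1, by omega⟩
      simp [hj, List.replicate_succ, isTally])
    (by simp [isTally])
    (fun i hi => by
      obtain ⟨j, hj⟩ : ∃ j, n - i = j + 1 := ⟨n - i - 1, by omega⟩
      have hj' : n - (i + 1) = j := by omega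
      rw [hj, hj', unary_succ]
      refine RunsIn.move_seq (T := 1 + (1 + (1 + 1))) (r := unary j ++ .sep :: w) rfl
        (RunsIn.push_seq (RunsIn.push_seq (RunsIn.push_seq ?_)))
      have := RunsIn.push .ctr .tally (contents (unary j ++ .sep :: w) (unary (2 * (i + 1))) []
        (unary (2 * i + 1)) [] [] [] [] [] [] [])
      simpa [Nat.mul_add, List.replicate_succ] using this)
  simp only [Nat.sub_self, Nat.sub_zero] at h
  refine (h.seq (RunsIn.move_seq (a := .sep) (r := w) rfl (RunsIn.push_seq (RunsIn.push_seq
    (RunsIn.push_seq (RunsIn.push_seq (RunsIn.push_seq (RunsIn.push_seq (RunsIn.push_seq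
    (T := 1) ?_))))))))).mono (by omega)
  have := RunsIn.push .ctr .tally (contents w (unary (2 * n + 4)) []
        (unary (2 * n + 3)) [] [] [] [] [] [] [])
  simpa [List.replicate_succ] using this

/-- The row of the vertex that sees the two literals of the pair `i`. -/
def pairRow (D i : ℕ) : List Bool :=
  List.replicate (2 * i) false ++ true :: true :: List.replicate (D - 2 * (i + 1)) false

/-- Store the rows of the pairs of literals. -/
def storePairs : StackProg ReductionStack Symbol :=
  .loop .ctr Option.isSome (.seq (.move .ctr []) (.seq (.move .ctr [])
    (.seq (fill .ctr .tmp .vec .neg) (.seq (.push .vec .pos) (.seq (.push .vec .pos)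
    (.seq (fill .pre .tmp .vec .neg) (.seq storeRows (.seq (drain .vec [])
    (.seq (.push .pre .tally) (.push .pre .tally))))))))))

/-- Invariant: before round `i`, the stack `pre` counts the positions to the left of pair `i`, and
`ctr` those from pair `i` on. As a stack is filled from the right end of the row, the zeros counted
by `ctr`, less the two of the pair, come first, then two ones, then the zeros counted by `pre`. In
the end `pre` holds `D`, which later counts the columns. -/
theorem runsIn_storePairs (inp rest out : List Symbol) {D N : ℕ} (hD : D = 2 * N) :
    storePairs.RunsIn
      (contents inp (unary D) [] (unary D) [] [] [] [] rest [] out)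
      (contents inp (unary D) (unary D) [] [] [] []
        (encodeRows (stackRows D ((List.range N).map (pairRow D)) [])) rest
        (unary (stackRows D ((List.range N).map (pairRow D)) []).length) out)
      (N * (D * (4 * D + 8) + 12 * D + 15) + 1) := by
  have h := RunsIn.loop_nat (k := .ctr) (p := Option.isSome)
    (T := D * (4 * D + 8) + 12 * D + 14)
    (P := .seq (.move .ctr []) (.seq (.move .ctr [])
      (.seq (fill .ctr .tmp .vec .neg) (.seq (.push .vec .pos) (.seq (.push .vec .pos)
      (.seq (fill .pre .tmp .vec .neg) (.seq storeRows (.seq (drain .vec [])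
      (.seq (.push .pre .tally) (.push .pre .tally))))))))))
    (fun i => contents inp (unary D) (unary (2 * i)) (unary (2 * (N - i))) [] [] []
        (encodeRows (stackRows D ((List.range i).map (pairRow D)) [])) rest
        (unary (stackRows D ((List.range i).map (pairRow D)) []).length) out) N
    (fun i hi => by simp only [contents_ctr, head?_unary_isSome]; simp; omega)
    (by simp)
    (fun i hi => by
      obtain ⟨j, hj⟩ : ∃ j, N - i = j + 1 := ⟨N - i - 1, by omega⟩
      have hj' : N - (i + 1) = j := by omega
      rw [hj, hj', show 2 * (j + 1) = 2 * j + 1 + 1 by ring, unary_succ, unary_succ]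
      have hv : (pairRow D i).length = D := by
        simp [pairRow]; omega
      have hb : bits (pairRow D i) = List.replicate (2 * i) .neg ++ .pos :: .pos ::
          List.replicate (2 * j) .neg := by
        simp [pairRow, show D - 2 * (i + 1) = 2 * j by omega]
      set R := stackRows D ((List.range i).map (pairRow D)) [] with hR
      have e : stackRows D ((List.range (i + 1)).map (pairRow D)) [] =
          List.replicate D (pairRow D i) ++ R := by
        rw [List.range_succ, List.map_append, stackRows_append]
        simp [← hR]
      rw [e]
      have h₁ := RunsIn.fill (c := ReductionStack.ctr) (t := .tmp) (k := .vec) (by decide)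
        (by decide) (by decide) .neg (2 * j) (contents inp (unary D) (unary (2 * i))
        (unary (2 * j)) [] [] [] (encodeRows R) rest (unary R.length) out) rfl rfl
      have h₂ := RunsIn.fill (c := ReductionStack.pre) (t := .tmp) (k := .vec) (by decide)
        (by decide) (by decide) .neg (2 * i) (contents inp (unary D) (unary (2 * i))
        (unary (2 * j)) [] (.pos :: .pos :: List.replicate (2 * j) .neg) [] (encodeRows R) rest
        (unary R.length) out) rfl rfl
      have h₃ := runsIn_storeRows inp (unary (2 * i)) (unary (2 * j)) rest out hv R
      have h₄ := RunsIn.clear .vec (contents inp (unary D) (unary (2 * i))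
        (unary (2 * j)) [] (bits (pairRow D i)) [] (encodeRows (List.replicate D (pairRow D i) ++ R))
        rest (unary (List.replicate D (pairRow D i) ++ R).length) out)
      simp only [contents_vec, update_contents_vec, List.append_nil, length_bits, hv]
        at h₁ h₂ h₄
      rw [← hb] at h₂
      refine RunsIn.mono (T := 1 + (1 + ((2 * j * 5 + 2) + (1 + (1 + ((2 * i * 5 + 2) +
        ((D * (4 * D + 8) + 2) + ((2 * D + 1) + (1 + 1))))))))) ?_ ?_
      · refine RunsIn.move_seq (r := .tally :: unary (2 * j)) rfl ?_
        simp only [pushAll_nil, update_contents_ctr]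
        refine RunsIn.move_seq (r := unary (2 * j)) rfl ?_
        simp only [pushAll_nil, update_contents_ctr]
        refine h₁.seq (RunsIn.push_seq (RunsIn.push_seq ?_))
        simp only [contents_vec, update_contents_vec]
        refine h₂.seq (h₃.seq (h₄.seq (RunsIn.push_seq ?_)))
        simp only [contents_pre, update_contents_pre]
        have := RunsIn.push .pre .tally (contents inp (unary D) (unary (2 * i + 1)) (unary (2 * j))
          [] [] [] (encodeRows (List.replicate D (pairRow D i) ++ R)) rest
          (unary (List.replicate D (pairRow D i) ++ R).length) out)
        simp only [contents_pre, update_contents_pre] at this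
        exact this
      · generalize D * (4 * D + 8) = X
        omega)
  simp only [Nat.sub_self, Nat.sub_zero, ← hD, Nat.mul_zero] at h
  exact h.mono (by apply le_of_eq; ring)

/-- The row of the vertex that sees only the negative literal of the pair `0`. -/
def unitRow (D : ℕ) : List Bool :=
  false :: true :: List.replicate (D - 2) false

/-- The row of the vertex that sees all literals. -/
def fullRow (D : ℕ) : List Bool :=
  List.replicate D true

/-- Store the two special rows. -/
def storeSpecial : StackProg ReductionStack Symbol :=
  .seq (fill .dim .tmp .vec .neg) (.seq (.move .vec []) (.seq (.move .vec [])
    (.seq (.push .vec .pos) (.seq (.push .vec .neg) (.seq storeRows (.seq (drain .vec [])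
    (.seq (fill .dim .tmp .vec .pos) (.seq storeRows (drain .vec [])))))))))

/-- The unit row arises from `D` zeros by exchanging the two topmost symbols; the one is pushed
before the zero, so it lands at position `1`. -/
theorem runsIn_storeSpecial (inp pre ctr rest out : List Symbol) {D : ℕ} (hD : 2 ≤ D)
    (R : List (List Bool)) :
    storeSpecial.RunsIn
      (contents inp (unary D) pre ctr [] [] [] (encodeRows R) rest (unary R.length) out)
      (contents inp (unary D) pre ctr [] [] []
        (encodeRows (stackRows D [unitRow D, fullRow D] R)) rest
        (unary (stackRows D [unitRow D, fullRow D] R).length) out)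
      (2 * (D * (4 * D + 8)) + 14 * D + 14) := by
  obtain ⟨E, rfl⟩ : ∃ E, D = E + 2 := ⟨D - 2, by omega⟩
  have hu : (unitRow (E + 2)).length = E + 2 := by simp [unitRow]
  have hf : (fullRow (E + 2)).length = E + 2 := by simp [fullRow]
  have hbu : bits (unitRow (E + 2)) = .neg :: .pos :: List.replicate E .neg := by simp [unitRow]
  have hbf : bits (fullRow (E + 2)) = List.replicate (E + 2) .pos := by simp [fullRow]
  set R₁ := List.replicate (E + 2) (unitRow (E + 2)) ++ R with hR₁
  have e : stackRows (E + 2) [unitRow (E + 2), fullRow (E + 2)] R =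
      List.replicate (E + 2) (fullRow (E + 2)) ++ R₁ := rfl
  rw [e]
  set R₂ := List.replicate (E + 2) (fullRow (E + 2)) ++ R₁ with hR₂
  have h₁ := RunsIn.fill (c := ReductionStack.dim) (t := .tmp) (k := .vec) (by decide)
    (by decide) (by decide) .neg (E + 2) (contents inp (unary (E + 2)) pre ctr [] [] []
    (encodeRows R) rest (unary R.length) out) rfl rfl
  have h₂ := runsIn_storeRows inp pre ctr rest out hu R
  have h₃ := RunsIn.clear .vec (contents inp (unary (E + 2)) pre ctr [] (bits (unitRow (E + 2))) []
    (encodeRows R₁) rest (unary R₁.length) out)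
  have h₄ := RunsIn.fill (c := ReductionStack.dim) (t := .tmp) (k := .vec) (by decide)
    (by decide) (by decide) .pos (E + 2) (contents inp (unary (E + 2)) pre ctr [] [] []
    (encodeRows R₁) rest (unary R₁.length) out) rfl rfl
  have h₅ := runsIn_storeRows inp pre ctr rest out hf R₁
  have h₆ := RunsIn.clear .vec (contents inp (unary (E + 2)) pre ctr [] (bits (fullRow (E + 2))) []
    (encodeRows R₂) rest (unary R₂.length) out)
  simp only [contents_vec, update_contents_vec, List.append_nil, length_bits, hu, hf]
    at h₁ h₃ h₄ h₆
  rw [← hbf] at h₄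
  rw [hbu] at h₂ h₃
  refine (h₁.seq (RunsIn.move_seq (a := .neg) (r := .neg :: List.replicate E .neg) rfl
    (RunsIn.move_seq (a := .neg) (r := List.replicate E .neg) rfl (RunsIn.push_seq
    (RunsIn.push_seq (T := 2 * ((E + 2) * (4 * (E + 2) + 8)) + 9 * (E + 2) + 8) ?_))))).mono ?_
  · simp only [pushAll_nil, contents_vec, update_contents_vec]
    refine (h₂.seq (h₃.seq (h₄.seq (h₅.seq h₆)))).mono ?_
    generalize (E + 2) * (4 * (E + 2) + 8) = X
    omega
  · generalize (E + 2) * (4 * (E + 2) + 8) = X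
    omega

end StackProg

/-! ### The rows of the clauses -/

namespace StackProg

/-- Set up the row of a clause: it contains the positive literal of the pair `0`. -/
def startClause : StackProg ReductionStack Symbol :=
  .seq (fill .dim .tmp .vec .neg) (.seq (.move .vec []) (.push .vec .pos))

/-- Go one position to the right in the row under construction. -/
def stepRight : StackProg ReductionStack Symbol :=
  .move .vec [.aux]

/-- Set the bit at the current position, and go back to the start of the row. -/
def setBit : StackProg ReductionStack Symbol :=
  .seq (.move .vec []) (.seq (.push .vec .pos) (drain .aux [.vec]))

/-- Process one symbol of the list of clauses. -/
def clauseStep : StackProg ReductionStack Symbol :=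
  .ite .inp isTally (.seq (.move .inp []) (.seq stepRight stepRight))
    (.ite .inp isSep (.seq (.move .inp []) (.seq storeRows (.seq (drain .vec []) startClause)))
      (.ite .inp isPos
        (.seq (.move .inp []) (.seq stepRight (.seq stepRight (.seq stepRight (.seq stepRight
          setBit)))))
        (.seq (.move .inp []) (.seq stepRight (.seq stepRight (.seq stepRight (.seq stepRight
          (.seq stepRight setBit))))))))

/-- Process all symbols of the list of clauses. -/
def clauseLoop : StackProg ReductionStack Symbol :=
  .loop .inp Option.isSome clauseStep

/-- Store the rows of the clauses. -/
def storeClauses : StackProg ReductionStack Symbol :=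
  .seq startClause (.seq clauseLoop (drain .vec []))

/-- The row of a clause without literals. -/
def emptyClauseRow (D : ℕ) : List Bool :=
  true :: List.replicate (D - 1) false

/-- The position of a literal in a row. -/
def literalPosition {n : ℕ} (l : Fin n × Bool) : ℕ :=
  2 * (l.1 : ℕ) + 4 + if l.2 then 0 else 1

/-- The row of a clause. -/
def clauseRow {n : ℕ} (D : ℕ) (c : List (Fin n × Bool)) : List Bool :=
  c.foldl (fun v l => v.set (literalPosition l) true) (emptyClauseRow D)

/-- The stacks while the row `v` is under construction and the current position is `p`. -/
def zipper (D p : ℕ) (v : List Bool) (inp pre ctr rest out : List Symbol) (R : List (List Bool)) :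
    ReductionStack → List Symbol :=
  contents inp (unary D) pre ctr [] (bits (v.drop p)) (bits (v.take p)).reverse (encodeRows R) rest
    (unary R.length) out

section

variable {D : ℕ} (inp pre ctr rest out : List Symbol) (R : List (List Bool))

theorem runsIn_startClause (hD : 0 < D) :
    startClause.RunsIn
      (contents inp (unary D) pre ctr [] [] [] (encodeRows R) rest (unary R.length) out)
      (zipper D 0 (emptyClauseRow D) inp pre ctr rest out R) (5 * D + 4) := by
  obtain ⟨E, rfl⟩ : ∃ E, D = E + 1 := ⟨D - 1, by omega⟩
  have h₁ := RunsIn.fill (c := ReductionStack.dim) (t := .tmp) (k := .vec) (by decide)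
    (by decide) (by decide) .neg (E + 1) (contents inp (unary (E + 1)) pre ctr [] [] []
    (encodeRows R) rest (unary R.length) out) rfl rfl
  simp only [contents_vec, update_contents_vec, List.append_nil] at h₁
  refine RunsIn.mono (T := ((E + 1) * 5 + 2) + (1 + 1)) (h₁.seq ?_) (by omega)
  refine RunsIn.move_seq (a := .neg) (r := List.replicate E .neg) rfl ?_
  simp only [pushAll_nil, update_contents_vec]
  have := RunsIn.push .vec .pos (contents inp (unary (E + 1)) pre ctr [] (List.replicate E .neg) []
    (encodeRows R) rest (unary R.length) out)
  simp only [contents_vec, update_contents_vec] at this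
  simpa [zipper, emptyClauseRow] using this

theorem runsIn_stepRight {p : ℕ} {v : List Bool} (hp : p < v.length) :
    stepRight.RunsIn (zipper D p v inp pre ctr rest out R)
      (zipper D (p + 1) v inp pre ctr rest out R) 1 := by
  have h := RunsIn.move (s := zipper D p v inp pre ctr rest out R) (k := .vec) [.aux]
    (a := if v[p] then .pos else .neg) (r := bits (v.drop (p + 1))) (by
      rw [zipper, contents_vec, List.drop_eq_getElem_cons hp, bits_cons])
  simp only [zipper, pushAll_cons, pushAll_nil, contents_aux, update_contents_vec,
    update_contents_aux] at h
  have e : bits (v.take (p + 1)) = bits (v.take p) ++ [if v[p] then .pos else .neg] := by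
    rw [List.take_add_one, List.getElem?_eq_getElem hp, bits_append]
    rfl
  rw [stepRight, zipper, zipper, e]
  simpa using h

/-- Replacing the bit takes two steps; the rest of the time goes into bringing back the `p` bits to
the left. -/
theorem runsIn_setBit {p : ℕ} {v : List Bool} (hp : p < v.length) :
    setBit.RunsIn (zipper D p v inp pre ctr rest out R)
      (zipper D 0 (v.set p true) inp pre ctr rest out R) (2 * p + 3) := by
  refine RunsIn.mono (T := 1 + (1 + (2 * p + 1))) ?_ (by omega)
  refine RunsIn.move_seq (a := if v[p] then .pos else .neg) (r := bits (v.drop (p + 1))) (by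
      rw [zipper, contents_vec, List.drop_eq_getElem_cons hp, bits_cons]) ?_
  simp only [zipper, pushAll_nil, update_contents_vec]
  refine RunsIn.push_seq ?_
  simp only [contents_vec, update_contents_vec]
  have := RunsIn.drain_one (k := .aux) (k₁ := .vec) (by decide) (contents inp (unary D) pre ctr []
    (.pos :: bits (v.drop (p + 1))) (bits (v.take p)).reverse (encodeRows R) rest
    (unary R.length) out)
  simp only [contents_aux, contents_vec, update_contents_aux, update_contents_vec,
    List.reverse_reverse, List.length_reverse, length_bits, List.length_take] at this
  rw [min_eq_left hp.le] at this
  have e : bits (v.set p true) = bits (v.take p) ++ .pos :: bits (v.drop (p + 1)) := by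
    rw [List.set_eq_take_append_cons_drop, if_pos hp, bits_append, bits_cons]
    rfl
  simpa [e] using this

variable {s : ReductionStack → List Symbol} {T : ℕ} {v : List Bool}

/-- The run on the remaining input is a hypothesis, so that pieces of the input can be prepended one
at a time. A tally advances by two positions, the width of a pair. -/
theorem runsIn_clauseLoop_tallies {p i : ℕ} (hp : p + 2 * i ≤ v.length)
    (h : clauseLoop.RunsIn (zipper D (p + 2 * i) v inp pre ctr rest out R) s T) :
    clauseLoop.RunsIn (zipper D p v (unary i ++ inp) pre ctr rest out R) s (5 * i + T) := by
  induction i generalizing p with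
  | zero => simpa using h
  | succ i ih =>
    rw [show p + 2 * (i + 1) = p + 1 + 1 + 2 * i by ring] at h hp
    refine RunsIn.mono (RunsIn.loop_true (T := 1 + (1 + (1 + 1))) rfl ?_ (ih hp h)) (by omega)
    refine RunsIn.ite_true rfl (RunsIn.move_seq (a := .tally) (r := unary i ++ inp) rfl ?_)
    simp only [zipper, pushAll_nil, update_contents_inp]
    exact (runsIn_stepRight _ pre ctr rest out R (by omega)).seq
      (runsIn_stepRight _ pre ctr rest out R (by omega))

/-- After the tallies the current position is `2 i`; four steps to the right skip the auxiliary
pairs, and a negative sign asks for one step more. -/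
theorem runsIn_clauseLoop_literal {n : ℕ} (l : Fin n × Bool) (hn : 2 * n + 4 ≤ v.length)
    (h : clauseLoop.RunsIn (zipper D 0 (v.set (literalPosition l) true) inp pre ctr rest out R)
      s T) :
    clauseLoop.RunsIn (zipper D 0 v (ThreeCNF.encodeLiteral l ++ inp) pre ctr rest out R) s
      (7 * v.length + 13 + T) := by
  obtain ⟨⟨i, hi⟩, b⟩ := l
  rw [ThreeCNF.encodeLiteral, List.append_assoc]
  refine RunsIn.mono (runsIn_clauseLoop_tallies _ pre ctr rest out R (by simp only; omega) ?_)
    (T := 5 * i + (1 + (2 * v.length + 12) + T)) (by omega)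
  simp only [zero_add, literalPosition] at h ⊢
  have hm {q : ℕ} (hq : q < v.length) := runsIn_stepRight (D := D) inp pre ctr rest out R hq
  cases b
  · simp only [Bool.false_eq_true, if_false] at h ⊢
    refine RunsIn.loop_true rfl ?_ h
    refine RunsIn.mono (T := 1 + (1 + (1 + (1 + (1 + (1 + (1 + (1 + (1 +
      (2 * (2 * i + 4 + 1) + 3)))))))))) ?_ (by omega)
    refine RunsIn.ite_false rfl (RunsIn.ite_false rfl (RunsIn.ite_false rfl
      (RunsIn.move_seq (a := .neg) (r := inp) rfl ?_)))
    simp only [zipper, pushAll_nil, update_contents_inp]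
    exact (hm (by omega)).seq ((hm (by omega)).seq ((hm (by omega)).seq ((hm (by omega)).seq
      ((hm (by omega)).seq (runsIn_setBit inp pre ctr rest out R (by omega))))))
  · simp only [if_true] at h ⊢
    refine RunsIn.loop_true rfl ?_ h
    refine RunsIn.mono (T := 1 + (1 + (1 + (1 + (1 + (1 + (1 + (1 +
      (2 * (2 * i + 4) + 3))))))))) ?_ (by omega)
    refine RunsIn.ite_false rfl (RunsIn.ite_false rfl (RunsIn.ite_true rfl
      (RunsIn.move_seq (a := .pos) (r := inp) rfl ?_)))
    simp only [zipper, pushAll_nil, update_contents_inp]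
    exact (hm (by omega)).seq ((hm (by omega)).seq ((hm (by omega)).seq ((hm (by omega)).seq
      (runsIn_setBit inp pre ctr rest out R (by omega)))))

theorem runsIn_clauseLoop_literals {n : ℕ} (c : List (Fin n × Bool)) (hn : 2 * n + 4 ≤ v.length)
    (h : clauseLoop.RunsIn (zipper D 0 (c.foldl (fun v l => v.set (literalPosition l) true) v)
      inp pre ctr rest out R) s T) :
    clauseLoop.RunsIn (zipper D 0 v (c.flatMap ThreeCNF.encodeLiteral ++ inp) pre ctr rest out R) s
      (c.length * (7 * v.length + 13) + T) := by
  induction c generalizing v with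
  | nil => simpa using h
  | cons l c ih =>
    have h₁ := ih (v := v.set (literalPosition l) true) (by simpa using hn) h
    rw [List.flatMap_cons, List.append_assoc]
    refine (runsIn_clauseLoop_literal _ pre ctr rest out R l hn h₁).mono (le_of_eq ?_)
    simp only [List.length_cons, List.length_set]
    ring

theorem length_clauseRow {n : ℕ} (hD : 0 < D) (c : List (Fin n × Bool)) :
    (clauseRow D c).length = D := by
  have h : ∀ v : List Bool,
      (c.foldl (fun v l => v.set (literalPosition l) true) v).length = v.length := by
    induction c with
    | nil => simp
    | cons l c ih => simp [ih]
  rw [clauseRow, h]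
  simp [emptyClauseRow]
  omega

theorem runsIn_clauseLoop_clause {n : ℕ} (c : List (Fin n × Bool)) (hc : c.length ≤ 3)
    (hn : D = 2 * n + 4)
    (h : clauseLoop.RunsIn (zipper D 0 (emptyClauseRow D) inp pre ctr rest out
      (List.replicate D (clauseRow D c) ++ R)) s T) :
    clauseLoop.RunsIn (zipper D 0 (emptyClauseRow D)
      (c.flatMap ThreeCNF.encodeLiteral ++ .sep :: inp) pre ctr rest out R) s
      (D * (4 * D + 8) + 28 * D + 50 + T) := by
  have he : (emptyClauseRow D).length = D := by simp [emptyClauseRow]; omega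
  refine RunsIn.mono (runsIn_clauseLoop_literals _ pre ctr rest out R c (by omega)
    (T := 1 + (D * (4 * D + 8) + 7 * D + 10) + T) ?_) ?_
  · refine RunsIn.loop_true rfl ?_ h
    refine RunsIn.mono (T := 1 + (1 + (1 + ((D * (4 * D + 8) + 2) + ((2 * D + 1) +
      (5 * D + 4)))))) ?_ (by omega)
    refine RunsIn.ite_false rfl (RunsIn.ite_true rfl
      (RunsIn.move_seq (a := .sep) (r := inp) rfl ?_))
    have hv := length_clauseRow (by omega : 0 < D) c
    have h₁ := runsIn_storeRows inp pre ctr rest out hv R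
    have h₂ := RunsIn.clear .vec (contents inp (unary D) pre ctr [] (bits (clauseRow D c)) []
      (encodeRows (List.replicate D (clauseRow D c) ++ R)) rest
      (unary (List.replicate D (clauseRow D c) ++ R).length) out)
    have h₃ := runsIn_startClause inp pre ctr rest out (List.replicate D (clauseRow D c) ++ R)
      (by omega : 0 < D)
    simp only [contents_vec, update_contents_vec, length_bits, hv] at h₂
    simp only [zipper, pushAll_nil, update_contents_inp, List.take_zero, List.drop_zero, bits_nil,
      List.reverse_nil] at h₃ ⊢
    exact h₁.seq (h₂.seq h₃)
  · rw [he]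
    -- Three literals cost at most `21 D + 39`; the separator adds `7 D + 11`.
    have := Nat.mul_le_mul_right (7 * D + 13) hc
    omega

theorem runsIn_clauseLoop {n : ℕ} (cs : List (List (Fin n × Bool)))
    (hcs : ∀ c ∈ cs, c.length ≤ 3) (hn : D = 2 * n + 4) :
    clauseLoop.RunsIn (zipper D 0 (emptyClauseRow D)
      (cs.flatMap fun c => c.flatMap ThreeCNF.encodeLiteral ++ [.sep]) pre ctr rest out R)
      (zipper D 0 (emptyClauseRow D) [] pre ctr rest out (stackRows D (cs.map (clauseRow D)) R))
      (cs.length * (D * (4 * D + 8) + 28 * D + 50) + 1) := by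
  induction cs generalizing R with
  | nil => simpa [clauseLoop] using RunsIn.loop_false rfl
  | cons c cs ih =>
    have h := ih (List.replicate D (clauseRow D c) ++ R) (fun c hc => hcs c (by simp [hc]))
    rw [List.flatMap_cons, List.append_assoc]
    refine (runsIn_clauseLoop_clause _ pre ctr rest out R c (hcs c (by simp)) hn h).mono
      (le_of_eq ?_)
    simp only [List.length_cons]
    ring

/-- Every separator starts the row of a next clause, so one unused row remains after the last clause
and has to be cleared. -/
theorem runsIn_storeClauses {n : ℕ} (cs : List (List (Fin n × Bool)))
    (hcs : ∀ c ∈ cs, c.length ≤ 3) (hn : D = 2 * n + 4) :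
    storeClauses.RunsIn
      (contents (cs.flatMap fun c => c.flatMap ThreeCNF.encodeLiteral ++ [.sep]) (unary D) pre ctr
        [] [] [] (encodeRows R) rest (unary R.length) out)
      (contents [] (unary D) pre ctr [] [] []
        (encodeRows (stackRows D (cs.map (clauseRow D)) R)) rest
        (unary (stackRows D (cs.map (clauseRow D)) R).length) out)
      (cs.length * (D * (4 * D + 8) + 28 * D + 50) + 7 * D + 6) := by
  have h₁ := runsIn_startClause (D := D)
    (cs.flatMap fun c => c.flatMap ThreeCNF.encodeLiteral ++ [.sep]) pre ctr rest out R (by omega)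
  have h₂ := runsIn_clauseLoop pre ctr rest out R cs hcs hn
  have h₃ := RunsIn.clear .vec (zipper D 0 (emptyClauseRow D) [] pre ctr rest out
    (stackRows D (cs.map (clauseRow D)) R))
  have he : (emptyClauseRow D).length = D := by simp [emptyClauseRow]; omega
  refine RunsIn.mono (T := 5 * D + 4 + (cs.length * (D * (4 * D + 8) + 28 * D + 50) + 1 + (2 * D + 1))) ?_ (by omega)
  have h := h₁.seq (h₂.seq h₃)
  simpa [storeClauses, zipper, he] using h

end

end StackProg

/-! ### Writing the adjacency matrix and the bound -/

namespace StackProg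

/-- Write the rows of the clause vertices of the adjacency matrix. -/
def writeClauseRows : StackProg ReductionStack Symbol :=
  .seq (.loop .rows Option.isSome (.seq (fill .cnt .tmp .out .neg)
    (.seq (.loop .rows isNotSep (.move .rows [.rest, .out])) (.move .rows [.rest]))))
    (drain .rest [.rows])

/-- Write one row of a literal vertex of the adjacency matrix, consisting of the first bits of the
stored rows, which are removed. -/
def writeLiteralRow : StackProg ReductionStack Symbol :=
  .seq (.loop .rows Option.isSome (.seq (.move .rows [.out])
    (.seq (.loop .rows isNotSep (.move .rows [.rest])) (.move .rows [.rest]))))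
    (.seq (drain .rest [.rows]) (fill .dim .tmp .out .neg))

/-- Write the rows of the literal vertices of the adjacency matrix. -/
def writeLiteralRows : StackProg ReductionStack Symbol :=
  .loop .pre Option.isSome (.seq (.move .pre []) writeLiteralRow)

/-- Write half of the number of literal vertices in unary. -/
def writeHalf : StackProg ReductionStack Symbol :=
  .loop .dim Option.isSome (.seq (.move .dim []) (.seq (.move .dim []) (.push .out .tally)))

/-- Write the graph, given its rows, and the bound on the membership. -/
def writeInstance : StackProg ReductionStack Symbol :=
  .seq (fill .cnt .tmp .out .tally) (.seq (fill .dim .tmp .out .tally) (.seq (.push .out .sep)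
    (.seq writeClauseRows (.seq writeLiteralRows (.seq (.push .out .sep) writeHalf)))))

section

variable {D : ℕ} (inp pre ctr vec : List Symbol) (M : ℕ)

/-- The stacks during the output of `w`, of which the rows `R` are left and the rows `R'` done. -/
def output (inp dim pre ctr : List Symbol) (M : ℕ) (rows rest w : List Symbol) :
    ReductionStack → List Symbol :=
  contents inp dim pre ctr [] [] [] rows rest (unary M) w.reverse

theorem isNotSep_bit (b : Bool) : isNotSep (some (if b then Symbol.pos else Symbol.neg)) = true := by
  cases b <;> rfl

/-- The bits written are also saved, reversed, on `rest`, because the rows are needed again for the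
columns. -/
theorem runsIn_writeBits (inp dim pre ctr : List Symbol) (v : List Bool) (r rest w : List Symbol) :
    (StackProg.loop ReductionStack.rows isNotSep (.move .rows [.rest, .out])).RunsIn
      (output inp dim pre ctr M (bits v ++ .sep :: r) rest w)
      (output inp dim pre ctr M (.sep :: r) ((bits v).reverse ++ rest) (w ++ bits v))
      (2 * v.length + 1) := by
  induction v generalizing rest w with
  | nil => simpa using RunsIn.loop_false rfl
  | cons b v ih =>
    have h := ih ((if b then .pos else .neg) :: rest) (w ++ [if b then .pos else .neg])
    have hm := RunsIn.move (k := .rows) [.rest, .out] (a := if b then Symbol.pos else .neg)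
      (r := bits v ++ .sep :: r)
      (s := output inp dim pre ctr M (bits (b :: v) ++ .sep :: r) rest w) rfl
    refine (RunsIn.loop_true (T := 1) (isNotSep_bit b) (hm.mono le_rfl) ?_).mono
      (T := 1 + 1 + (2 * v.length + 1)) (by simp only [List.length_cons]; omega)
    simpa [output] using h

theorem runsIn_skipBits (inp dim pre ctr : List Symbol) (v : List Bool) (r rest w : List Symbol) :
    (StackProg.loop ReductionStack.rows isNotSep (.move .rows [.rest])).RunsIn
      (output inp dim pre ctr M (bits v ++ .sep :: r) rest w)
      (output inp dim pre ctr M (.sep :: r) ((bits v).reverse ++ rest) w)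
      (2 * v.length + 1) := by
  induction v generalizing rest with
  | nil => simpa using RunsIn.loop_false rfl
  | cons b v ih =>
    have h := ih ((if b then .pos else .neg) :: rest)
    have hm := RunsIn.move (k := .rows) [.rest] (a := if b then Symbol.pos else .neg)
      (r := bits v ++ .sep :: r)
      (s := output inp dim pre ctr M (bits (b :: v) ++ .sep :: r) rest w) rfl
    refine (RunsIn.loop_true (T := 1) (isNotSep_bit b) (hm.mono le_rfl) ?_).mono
      (T := 1 + 1 + (2 * v.length + 1)) (by simp only [List.length_cons]; omega)
    simpa [output] using h

theorem head?_encodeRows_cons_isSome (v : List Bool) (R : List (List Bool)) :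
    (encodeRows (v :: R)).head?.isSome = true := by
  cases v <;> simp

theorem runsIn_restore (inp dim pre ctr : List Symbol) (R : List (List Bool))
    {E : ℕ} (hR : ∀ v ∈ R, v.length ≤ E) (w : List Symbol) :
    (drain .rest [.rows]).RunsIn (output inp dim pre ctr M [] (encodeRows R).reverse w)
      (output inp dim pre ctr M (encodeRows R) [] w) (2 * (R.length * (E + 1)) + 1) := by
  have hl : (encodeRows R).length ≤ R.length * (E + 1) := by
    induction R with
    | nil => simp
    | cons v R ih =>
      have h₁ := hR v (by simp)
      have h₂ := ih (fun v hv => hR v (by simp [hv]))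
      simp only [encodeRows_cons, List.length_append, length_bits, List.length_cons]
      rw [Nat.add_mul]
      omega
  have h := RunsIn.drain_one (k := .rest) (k₁ := .rows) (by decide)
    (output inp dim pre ctr M [] (encodeRows R).reverse w)
  refine RunsIn.mono (T := 2 * (encodeRows R).length + 1) ?_ (by omega)
  simpa [output] using h

/-- Row vertices come before position vertices and are pairwise nonadjacent, so each line of the
matrix is a block of `M` zeros followed by the bits of the row. -/
theorem runsIn_writeClauseRows (inp dim pre ctr : List Symbol) (R : List (List Bool))
    (hR : ∀ v ∈ R, v.length = D) (w : List Symbol) :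
    writeClauseRows.RunsIn (output inp dim pre ctr M (encodeRows R) [] w)
      (output inp dim pre ctr M (encodeRows R) []
        (w ++ R.flatMap fun v => List.replicate M .neg ++ bits v))
      (R.length * (5 * M + 4 * D + 7) + 2) := by
  have h : ∀ (R : List (List Bool)) (_ : ∀ v ∈ R, v.length = D) (rest w : List Symbol),
      (StackProg.loop ReductionStack.rows Option.isSome (.seq (fill .cnt .tmp .out .neg)
        (.seq (.loop .rows isNotSep (.move .rows [.rest, .out])) (.move .rows [.rest])))).RunsIn
      (output inp dim pre ctr M (encodeRows R) rest w)
      (output inp dim pre ctr M [] ((encodeRows R).reverse ++ rest)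
        (w ++ R.flatMap fun v => List.replicate M .neg ++ bits v))
      (R.length * (5 * M + 2 * D + 5) + 1) := by
    intro R
    induction R with
    | nil =>
      intro _ rest w
      simpa using RunsIn.loop_false rfl
    | cons v R ih =>
      intro hR rest w
      have hv := hR v (by simp)
      have h₁ := RunsIn.fill (c := ReductionStack.cnt) (t := .tmp) (k := .out) (by decide)
        (by decide) (by decide) .neg M (output inp dim pre ctr M (encodeRows (v :: R)) rest w)
        rfl rfl
      have h₂ := runsIn_writeBits M inp dim pre ctr v (encodeRows R) rest
        (w ++ List.replicate M .neg)
      have h₃ := RunsIn.move (k := .rows) [.rest] (a := Symbol.sep) (r := encodeRows R)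
        (s := output inp dim pre ctr M (.sep :: encodeRows R) ((bits v).reverse ++ rest)
          (w ++ List.replicate M .neg ++ bits v)) rfl
      have h₄ := ih (fun v hv => hR v (by simp [hv])) (.sep :: ((bits v).reverse ++ rest))
        (w ++ List.replicate M .neg ++ bits v)
      have e₁ : Function.update (output inp dim pre ctr M (encodeRows (v :: R)) rest w) .out
          (List.replicate M .neg ++ output inp dim pre ctr M (encodeRows (v :: R)) rest w .out) =
          output inp dim pre ctr M (bits v ++ .sep :: encodeRows R) rest
            (w ++ List.replicate M .neg) := by
        simp [output]
      rw [e₁] at h₁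
      have e₃ : pushAll Symbol.sep [.rest] (Function.update (output inp dim pre ctr M
          (.sep :: encodeRows R) ((bits v).reverse ++ rest) (w ++ List.replicate M .neg ++ bits v))
          .rows (encodeRows R)) = output inp dim pre ctr M (encodeRows R)
          (.sep :: ((bits v).reverse ++ rest)) (w ++ List.replicate M .neg ++ bits v) := by
        simp [output]
      rw [e₃] at h₃
      have h := RunsIn.loop_true (k := .rows) (p := Option.isSome)
        (head?_encodeRows_cons_isSome v R) (h₁.seq (h₂.seq h₃)) h₄
      rw [hv] at h
      have e : w ++ List.replicate M .neg ++ bits v ++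
          (R.flatMap fun v => List.replicate M .neg ++ bits v) =
          w ++ (v :: R).flatMap fun v => List.replicate M .neg ++ bits v := by simp
      have e' : (encodeRows R).reverse ++ Symbol.sep :: ((bits v).reverse ++ rest) =
          (encodeRows (v :: R)).reverse ++ rest := by simp
      rw [e, e'] at h
      refine h.mono (le_of_eq ?_)
      simp only [List.length_cons]
      ring
  have h₁ := h R hR [] w
  rw [List.append_nil] at h₁
  refine (h₁.seq (runsIn_restore M inp dim pre ctr R (fun v hv => (hR v hv).le) _)).mono
    (le_of_eq ?_)
  ring

/-- The line of a position is a column of the stored rows. It is obtained by peeling the first bit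
off every row, so that the next column becomes the first; `D` zeros follow because positions are
pairwise nonadjacent. -/
theorem runsIn_writeLiteralRow (inp pre ctr : List Symbol) {E : ℕ} (R : List (List Bool))
    (hR : ∀ v ∈ R, v.length = E + 1) (w : List Symbol) :
    writeLiteralRow.RunsIn (output inp (unary D) pre ctr M (encodeRows R) [] w)
      (output inp (unary D) pre ctr M (encodeRows (R.map List.tail)) []
        (w ++ (bits (R.map fun v => v.headD false) ++ List.replicate D .neg)))
      (R.length * (4 * E + 6) + 5 * D + 4) := by
  have h : ∀ (R : List (List Bool)) (_ : ∀ v ∈ R, v.length = E + 1) (rest w : List Symbol),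
      (StackProg.loop ReductionStack.rows Option.isSome (.seq (.move .rows [.out])
        (.seq (.loop .rows isNotSep (.move .rows [.rest])) (.move .rows [.rest])))).RunsIn
      (output inp (unary D) pre ctr M (encodeRows R) rest w)
      (output inp (unary D) pre ctr M [] ((encodeRows (R.map List.tail)).reverse ++ rest)
        (w ++ bits (R.map fun v => v.headD false)))
      (R.length * (2 * E + 4) + 1) := by
    intro R
    induction R with
    | nil =>
      intro _ rest w
      simpa using RunsIn.loop_false rfl
    | cons v R ih =>
      intro hR rest w
      have hv := hR v (by simp)
      obtain ⟨b, v, rfl⟩ : ∃ b u, v = b :: u := List.exists_cons_of_length_eq_add_one hv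
      simp only [List.length_cons, Nat.add_right_cancel_iff] at hv
      have h₁ := RunsIn.move (k := .rows) [.out] (a := if b then Symbol.pos else .neg)
        (r := bits v ++ .sep :: encodeRows R)
        (s := output inp (unary D) pre ctr M (encodeRows ((b :: v) :: R)) rest w) (by simp [output])
      have h₂ := runsIn_skipBits M inp (unary D) pre ctr v (encodeRows R) rest
        (w ++ [if b then .pos else .neg])
      have h₃ := RunsIn.move (k := .rows) [.rest] (a := Symbol.sep) (r := encodeRows R)
        (s := output inp (unary D) pre ctr M (.sep :: encodeRows R) ((bits v).reverse ++ rest)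
          (w ++ [if b then .pos else .neg])) rfl
      have h₄ := ih (fun v hv => hR v (by simp [hv])) (.sep :: ((bits v).reverse ++ rest))
        (w ++ [if b then .pos else .neg])
      have e₁ : pushAll (if b then Symbol.pos else .neg) [.out] (Function.update (output inp
          (unary D) pre ctr M (encodeRows ((b :: v) :: R)) rest w) .rows
          (bits v ++ .sep :: encodeRows R)) = output inp (unary D) pre ctr M
          (bits v ++ .sep :: encodeRows R) rest (w ++ [if b then .pos else .neg]) := by
        simp [output]
      rw [e₁] at h₁
      have e₃ : pushAll Symbol.sep [.rest] (Function.update (output inp (unary D) pre ctr M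
          (.sep :: encodeRows R) ((bits v).reverse ++ rest) (w ++ [if b then .pos else .neg]))
          .rows (encodeRows R)) = output inp (unary D) pre ctr M (encodeRows R)
          (.sep :: ((bits v).reverse ++ rest)) (w ++ [if b then .pos else .neg]) := by
        simp [output]
      rw [e₃] at h₃
      have h := RunsIn.loop_true (k := .rows) (p := Option.isSome)
        (head?_encodeRows_cons_isSome (b :: v) R) (h₁.seq (h₂.seq h₃)) h₄
      rw [hv] at h
      have e : w ++ [if b then Symbol.pos else .neg] ++ bits (R.map fun v => v.headD false) =
          w ++ bits (((b :: v) :: R).map fun v => v.headD false) := by simp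
      have e' : (encodeRows (R.map List.tail)).reverse ++ Symbol.sep :: ((bits v).reverse ++ rest) =
          (encodeRows (((b :: v) :: R).map List.tail)).reverse ++ rest := by simp
      rw [e, e'] at h
      refine h.mono (le_of_eq ?_)
      simp only [List.length_cons]
      ring
  have h₁ := h R hR [] w
  rw [List.append_nil] at h₁
  have h₂ := runsIn_restore M inp (unary D) pre ctr (R.map List.tail) (E := E)
    (fun v hv => by
      obtain ⟨u, hu, rfl⟩ := List.mem_map.mp hv
      simp [hR u hu]) (w ++ bits (R.map fun v => v.headD false))
  have h₃ := RunsIn.fill (c := ReductionStack.dim) (t := .tmp) (k := .out) (by decide)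
    (by decide) (by decide) .neg D (output inp (unary D) pre ctr M (encodeRows (R.map List.tail)) []
      (w ++ bits (R.map fun v => v.headD false))) rfl rfl
  have e : Function.update (output inp (unary D) pre ctr M (encodeRows (R.map List.tail)) []
      (w ++ bits (R.map fun v => v.headD false))) .out (List.replicate D .neg ++
      output inp (unary D) pre ctr M (encodeRows (R.map List.tail)) []
        (w ++ bits (R.map fun v => v.headD false)) .out) =
      output inp (unary D) pre ctr M (encodeRows (R.map List.tail)) []
        (w ++ (bits (R.map fun v => v.headD false) ++ List.replicate D .neg)) := by
    simp [output]
  rw [e] at h₃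
  refine (h₁.seq (h₂.seq h₃)).mono (le_of_eq ?_)
  rw [List.length_map]
  ring

/-- The number `E` of columns left decreases while the block of zeros keeps its length `D`, so the
induction separates the two numbers. -/
theorem runsIn_writeLiteralRows (inp ctr : List Symbol) {E : ℕ} (R : List (List Bool))
    (hR : ∀ v ∈ R, v.length = E) (hED : E ≤ D) (w : List Symbol) :
    writeLiteralRows.RunsIn (output inp (unary D) (unary E) ctr M (encodeRows R) [] w)
      (output inp (unary D) [] ctr M (encodeRows (R.map fun _ => [])) []
        (w ++ (List.range E).flatMap fun d =>
          bits (R.map fun v => v.getD d false) ++ List.replicate D .neg))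
      (E * (R.length * (4 * D + 6) + 5 * D + 6) + 1) := by
  induction E generalizing R w with
  | zero =>
    have e : R = R.map fun _ => [] := by
      conv_lhs => rw [← List.map_id R]
      exact List.map_congr_left fun v hv => List.length_eq_zero_iff.mp (hR v hv)
    rw [← e]
    simpa [writeLiteralRows] using RunsIn.loop_false rfl
  | succ E ih =>
    have h₁ := RunsIn.move (k := .pre) [] (a := Symbol.tally) (r := unary E)
      (s := output inp (unary D) (unary (E + 1)) ctr M (encodeRows R) [] w) rfl
    have e₁ : pushAll Symbol.tally [] (Function.update (output inp (unary D) (unary (E + 1)) ctr M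
        (encodeRows R) [] w) .pre (unary E)) =
        output inp (unary D) (unary E) ctr M (encodeRows R) [] w := by
      simp [output]
    rw [e₁] at h₁
    have h₂ := runsIn_writeLiteralRow (D := D) M inp (unary E) ctr R hR w
    have h₃ := ih (R.map List.tail) (fun v hv => by
      obtain ⟨u, hu, rfl⟩ := List.mem_map.mp hv
      simp [hR u hu]) (by omega)
      (w ++ (bits (R.map fun v => v.headD false) ++ List.replicate D .neg))
    rw [writeLiteralRows] at h₃ ⊢
    have h := RunsIn.loop_true (k := .pre) (p := Option.isSome) rfl (h₁.seq h₂) h₃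
    have e : w ++ (bits (R.map fun v => v.headD false) ++ List.replicate D .neg) ++
        ((List.range E).flatMap fun d =>
          bits ((R.map List.tail).map fun v => v.getD d false) ++ List.replicate D .neg) =
        w ++ (List.range (E + 1)).flatMap fun d =>
          bits (R.map fun v => v.getD d false) ++ List.replicate D .neg := by
      -- Column `d` of the shortened rows is column `d + 1` of the rows.
      rw [List.range_succ_eq_map, List.flatMap_cons, List.flatMap_map]
      have h₀ : (R.map fun v => v.headD false) = R.map fun v => v.getD 0 false :=
        List.map_congr_left fun v _ => by cases v <;> rfl
      have hs (d : ℕ) : ((R.map List.tail).map fun v => v.getD d false) =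
          R.map fun v => v.getD (d + 1) false := by
        rw [List.map_map]
        exact List.map_congr_left fun v _ => by cases v <;> simp
      simp only [h₀, hs, List.append_assoc]
    rw [e, List.map_map] at h
    refine h.mono ?_
    rw [List.length_map]
    have : R.length * (4 * E + 6) ≤ R.length * (4 * D + 6) := Nat.mul_le_mul_left _ (by omega)
    rw [Nat.add_mul]
    omega

theorem runsIn_writeHalf (inp pre ctr rows rest w : List Symbol) (N : ℕ) :
    writeHalf.RunsIn (output inp (unary (2 * N)) pre ctr M rows rest w)
      (output inp [] pre ctr M rows rest (w ++ unary N)) (N * 4 + 1) := by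
  have h := RunsIn.loop_nat (k := .dim) (p := Option.isSome) (T := 3)
    (P := .seq (.move .dim []) (.seq (.move .dim []) (.push .out .tally)))
    (fun i => output inp (unary (2 * (N - i))) pre ctr M rows rest (w ++ unary i)) N
    (fun i hi => by
      simp only [output, contents_dim, head?_unary_isSome]
      simp only [decide_eq_true_eq]
      omega)
    (by simp [output])
    (fun i hi => by
      obtain ⟨j, hj⟩ : ∃ j, N - i = j + 1 := ⟨N - i - 1, by omega⟩
      have hj' : N - (i + 1) = j := by omega
      rw [hj, hj', show 2 * (j + 1) = 2 * j + 1 + 1 by ring, unary_succ, unary_succ]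
      refine RunsIn.move_seq (T := 1 + 1) (r := .tally :: unary (2 * j)) rfl ?_
      simp only [output, pushAll_nil, update_contents_dim]
      refine RunsIn.move_seq (r := unary (2 * j)) rfl ?_
      simp only [pushAll_nil, update_contents_dim]
      have := RunsIn.push .out .tally (output inp (unary (2 * j)) pre ctr M rows rest (w ++ unary i))
      have e : w ++ unary (i + 1) = w ++ unary i ++ [.tally] := by
        rw [unary, List.replicate_succ', List.append_assoc]
      rw [e]
      simpa only [output, update_contents_out, contents_out, List.reverse_append,
        List.reverse_singleton, List.singleton_append] using this)
  simpa [writeHalf] using h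

/-- The word for the graph with the rows `R` of length `D`, with the bound `k` on the membership. -/
def instanceWord (D k : ℕ) (R : List (List Bool)) : List Symbol :=
  unary (R.length + D) ++ [.sep] ++
    ((R.flatMap fun v => List.replicate R.length .neg ++ bits v) ++
      (List.range D).flatMap fun d =>
        bits (R.map fun v => v.getD d false) ++ List.replicate D .neg) ++
    [.sep] ++ unary k

theorem runsIn_writeInstance (inp ctr : List Symbol) {k : ℕ} (hD : D = 2 * k)
    (R : List (List Bool)) (hR : ∀ v ∈ R, v.length = D) :
    writeInstance.RunsIn (output inp (unary D) (unary D) ctr R.length (encodeRows R) [] [])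
      (output inp [] [] ctr R.length (encodeRows (R.map fun _ => [])) [] (instanceWord D k R))
      (R.length * (5 * R.length + 4 * D + 12) + D * (R.length * (4 * D + 6) + 5 * D + 13) + 10) := by
  have h₁ := RunsIn.fill (c := ReductionStack.cnt) (t := .tmp) (k := .out) (by decide)
    (by decide) (by decide) .tally R.length
    (output inp (unary D) (unary D) ctr R.length (encodeRows R) [] []) rfl rfl
  have e₁ : Function.update (output inp (unary D) (unary D) ctr R.length (encodeRows R) [] []) .out
      (unary R.length ++ output inp (unary D) (unary D) ctr R.length (encodeRows R) [] [] .out) =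
      output inp (unary D) (unary D) ctr R.length (encodeRows R) [] (unary R.length) := by
    simp [output]
  rw [e₁] at h₁
  have h₂ := RunsIn.fill (c := ReductionStack.dim) (t := .tmp) (k := .out) (by decide)
    (by decide) (by decide) .tally D
    (output inp (unary D) (unary D) ctr R.length (encodeRows R) [] (unary R.length)) rfl rfl
  have e₂ : Function.update (output inp (unary D) (unary D) ctr R.length (encodeRows R) []
      (unary R.length)) .out (unary D ++ output inp (unary D) (unary D) ctr R.length (encodeRows R)
      [] (unary R.length) .out) = output inp (unary D) (unary D) ctr R.length (encodeRows R) []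
      (unary (R.length + D)) := by
    simp [output, Nat.add_comm]
  rw [e₂] at h₂
  have h₃ := RunsIn.push .out .sep (output inp (unary D) (unary D) ctr R.length (encodeRows R) []
      (unary (R.length + D)))
  have e₃ (dim pre rows w : List Symbol) : Function.update (output inp dim pre ctr R.length rows []
      w) .out (.sep :: output inp dim pre ctr R.length rows [] w .out) =
      output inp dim pre ctr R.length rows [] (w ++ [.sep]) := by
    simp [output]
  rw [e₃] at h₃
  have h₄ := runsIn_writeClauseRows R.length inp (unary D) (unary D) ctr R hR
    (unary (R.length + D) ++ [.sep])
  have h₅ := runsIn_writeLiteralRows (D := D) R.length inp ctr R hR le_rfl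
    (unary (R.length + D) ++ [.sep] ++ R.flatMap fun v => List.replicate R.length .neg ++ bits v)
  have h₆ := RunsIn.push .out .sep (output inp (unary D) [] ctr R.length
    (encodeRows (R.map fun _ => [])) [] (unary (R.length + D) ++ [.sep] ++
      (R.flatMap fun v => List.replicate R.length .neg ++ bits v) ++
      (List.range D).flatMap fun d =>
        bits (R.map fun v => v.getD d false) ++ List.replicate D .neg))
  rw [e₃] at h₆
  have h₇ := runsIn_writeHalf R.length inp [] ctr (encodeRows (R.map fun _ => [])) []
    (unary (R.length + D) ++ [.sep] ++
      (R.flatMap fun v => List.replicate R.length .neg ++ bits v) ++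
      ((List.range D).flatMap fun d =>
        bits (R.map fun v => v.getD d false) ++ List.replicate D .neg) ++ [.sep]) k
  rw [← hD] at h₇
  have h := h₁.seq (h₂.seq (h₃.seq (h₄.seq (h₅.seq (h₆.seq h₇)))))
  have e : unary (R.length + D) ++ [.sep] ++
      (R.flatMap fun v => List.replicate R.length .neg ++ bits v) ++
      ((List.range D).flatMap fun d =>
        bits (R.map fun v => v.getD d false) ++ List.replicate D .neg) ++ [.sep] ++ unary k =
      instanceWord D k R := by
    simp only [instanceWord, List.append_assoc]
  rw [e] at h
  refine h.mono ?_
  subst hD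
  ring_nf
  omega

end

/-- The program that writes, given a formula, a graph and a bound on the membership. -/
def reduction : StackProg ReductionStack Symbol :=
  .seq readHeader (.seq storePairs (.seq storeSpecial (.seq storeClauses writeInstance)))

end StackProg

/-! ### The rows of a formula and the running time of the reduction -/

namespace ThreeCNF

/-- The number of literal vertices. -/
def numLiterals (φ : ThreeCNF) : ℕ := 2 * φ.n + 4

/-- The rows of the graph of a formula, without repetitions. -/
def baseRows (φ : ThreeCNF) : List (List Bool) :=
  (List.range (φ.n + 2)).map (StackProg.pairRow φ.numLiterals) ++
    ([StackProg.unitRow φ.numLiterals, StackProg.fullRow φ.numLiterals] ++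
      φ.clauses.map (StackProg.clauseRow φ.numLiterals))

/-- The rows of the graph of a formula. -/
def graphRows (φ : ThreeCNF) : List (List Bool) :=
  StackProg.stackRows φ.numLiterals φ.baseRows []

theorem length_of_mem_baseRows {φ : ThreeCNF} {v : List Bool} (hv : v ∈ φ.baseRows) :
    v.length = φ.numLiterals := by
  simp only [baseRows, List.mem_append, List.mem_map, List.mem_range, List.mem_cons,
    List.not_mem_nil, or_false] at hv
  rcases hv with ⟨i, hi, rfl⟩ | (rfl | rfl) | ⟨c, hc, rfl⟩
  · simp [StackProg.pairRow, numLiterals]; omega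
  · simp [StackProg.unitRow, numLiterals]
  · simp [StackProg.fullRow]
  · exact StackProg.length_clauseRow (by simp [numLiterals]) c

end ThreeCNF

namespace StackProg

theorem mem_stackRows {D : ℕ} {base R : List (List Bool)} {v : List Bool}
    (hv : v ∈ stackRows D base R) : v ∈ base ∨ v ∈ R := by
  induction base generalizing R with
  | nil => exact .inr hv
  | cons u base ih =>
    rcases ih hv with h | h
    · exact .inl (by simp [h])
    · rcases List.mem_append.mp h with h | h
      · exact .inl (by simp [List.eq_of_mem_replicate h])
      · exact .inr h

theorem length_stackRows (D : ℕ) (base R : List (List Bool)) :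
    (stackRows D base R).length = D * base.length + R.length := by
  induction base generalizing R with
  | nil => simp
  | cons u base ih =>
    simp only [stackRows_cons, ih, List.length_append, List.length_replicate, List.length_cons]
    ring

end StackProg

namespace ThreeCNF

theorem length_of_mem_graphRows {φ : ThreeCNF} {v : List Bool} (hv : v ∈ φ.graphRows) :
    v.length = φ.numLiterals :=
  length_of_mem_baseRows ((StackProg.mem_stackRows hv).resolve_right List.not_mem_nil)

theorem length_graphRows (φ : ThreeCNF) :
    φ.graphRows.length = φ.numLiterals * (φ.n + φ.m + 4) := by
  rw [graphRows, StackProg.length_stackRows]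
  simp [baseRows, m]
  ring_nf
  simp

open StackProg

/-- With `X = n + m + 1` there are `O(X)` positions and `O(X ^ 2)` rows. The quartic terms come from
the zeros before each row, quadratic in the number of rows, and from the `D` passes over all rows
that extract the columns. -/
theorem runsIn_reduction (φ : ThreeCNF) :
    ∃ s, reduction.RunsIn (Function.update (fun _ => []) .inp φ.encode) s
      (10000 * (φ.n + φ.m + 1) ^ 4) ∧
      (s .out).reverse = instanceWord φ.numLiterals (φ.n + 2) φ.graphRows := by
  set D := φ.numLiterals with hD
  have hD' : D = 2 * φ.n + 4 := rfl
  have h₁ := runsIn_readHeader φ.n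
    (φ.clauses.flatMap fun c => c.flatMap encodeLiteral ++ [.sep])
  have h₂ := runsIn_storePairs (φ.clauses.flatMap fun c => c.flatMap encodeLiteral ++ [.sep]) [] []
    (D := D) (N := φ.n + 2) (by omega)
  set R₁ := stackRows D ((List.range (φ.n + 2)).map (pairRow D)) [] with hR₁
  have h₃ := runsIn_storeSpecial (φ.clauses.flatMap fun c => c.flatMap encodeLiteral ++ [.sep])
    (unary D) [] [] [] (D := D) (by omega) R₁
  set R₂ := stackRows D [unitRow D, fullRow D] R₁ with hR₂
  have h₄ := runsIn_storeClauses (D := D) (unary D) [] [] [] R₂ φ.clauses φ.length_le hD'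
  have hR : stackRows D (φ.clauses.map (clauseRow D)) R₂ = φ.graphRows := by
    rw [graphRows, baseRows, stackRows_append, stackRows_append]
  rw [hR] at h₄
  have h₅ := runsIn_writeInstance (D := D) [] [] (k := φ.n + 2) (by omega) φ.graphRows
    (fun v hv => length_of_mem_graphRows hv)
  have h := h₁.seq (h₂.seq (h₃.seq (h₄.seq h₅)))
  have e : Function.update (fun _ => []) .inp φ.encode =
      contents (unary φ.n ++ .sep :: φ.clauses.flatMap fun c => c.flatMap encodeLiteral ++ [.sep])
        [] [] [] [] [] [] [] [] [] [] := by
    funext k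
    cases k <;> simp [encode]
  rw [e]
  refine ⟨_, RunsIn.mono h ?_, List.reverse_reverse (instanceWord D (φ.n + 2) φ.graphRows)⟩
  rw [length_graphRows, ← hD]
  change _ + (_ + (_ + (φ.m * _ + _ + _ + _))) ≤ _
  generalize φ.m = m
  rw [hD']
  generalize φ.n = n
  obtain ⟨X, hX⟩ : ∃ X, X = n + m + 1 := ⟨_, rfl⟩
  rw [← hX]
  have hD₁ : 2 * n + 4 ≤ 4 * X := by omega
  have hM : (2 * n + 4) * (n + m + 4) ≤ 16 * X ^ 2 := by
    calc (2 * n + 4) * (n + m + 4) ≤ (4 * X) * (4 * X) := Nat.mul_le_mul hD₁ (by omega)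
      _ = _ := by ring
  have hn : n ≤ X := by omega
  have hn₂ : n + 2 ≤ 3 * X := by omega
  have hm : m ≤ X := by omega
  have hX₁ : 1 ≤ X := by omega
  generalize 2 * n + 4 = D at *
  generalize D * (n + m + 4) = M at *
  have p₀ : 1 ≤ X ^ 4 := Nat.one_le_pow _ _ hX₁
  have p₁ : X ≤ X ^ 4 := Nat.le_self_pow (by norm_num) X
  have p₂ : X ^ 2 ≤ X ^ 4 := Nat.pow_le_pow_right hX₁ (by norm_num)
  have p₃ : X ^ 3 ≤ X ^ 4 := Nat.pow_le_pow_right hX₁ (by norm_num)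
  have q₁ := Nat.mul_le_mul hD₁ (show 4 * D + 8 ≤ 16 * X + 8 by omega)
  have q₂ := Nat.mul_le_mul hn₂ (show D * (4 * D + 8) + 12 * D + 15 ≤
    4 * X * (16 * X + 8) + 12 * (4 * X) + 15 by omega)
  have q₃ := Nat.mul_le_mul hm (show D * (4 * D + 8) + 28 * D + 50 ≤
    4 * X * (16 * X + 8) + 28 * (4 * X) + 50 by omega)
  have q₄ := Nat.mul_le_mul hM (show 5 * M + 4 * D + 12 ≤ 5 * (16 * X ^ 2) + 4 * (4 * X) + 12 by
    omega)
  have q₅ := Nat.mul_le_mul hM (show 4 * D + 6 ≤ 4 * (4 * X) + 6 by omega)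
  have q₆ := Nat.mul_le_mul hD₁ (show M * (4 * D + 6) + 5 * D + 13 ≤
    16 * X ^ 2 * (4 * (4 * X) + 6) + 5 * (4 * X) + 13 by omega)
  linarith

end ThreeCNF

/-! ### Graphs given by rows of bits -/

/-- The bit at position `p` of the row `j`. -/
def rowBit (R : List (List Bool)) (j p : ℕ) : Bool :=
  (R.getD j []).getD p false

/-- Adjacency in the bipartite graph in which the vertex `j < R.length` and the vertex
`R.length + p` are adjacent when the row `j` has a bit at the position `p`. -/
def rowAdj (R : List (List Bool)) (a b : ℕ) : Bool :=
  (decide (a < R.length) && decide (R.length ≤ b) && rowBit R a (b - R.length)) ||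
    (decide (b < R.length) && decide (R.length ≤ a) && rowBit R b (a - R.length))

theorem rowAdj_comm (R : List (List Bool)) (a b : ℕ) : rowAdj R a b = rowAdj R b a :=
  Bool.or_comm _ _

/-- The bipartite graph given by rows of length `D`, with a bound on the membership. -/
def rowInstance (D k : ℕ) (hk : 0 < k) (R : List (List Bool)) : MMDSInstance where
  n := R.length + D
  G :=
    { Adj := fun a b => rowAdj R a b = true
      symm := ⟨fun a b h => by rw [rowAdj_comm]; exact h⟩
      loopless := ⟨fun a h => by
        simp only [rowAdj, Bool.or_eq_true, Bool.and_eq_true, decide_eq_true_eq] at h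
        omega⟩ }
  k := k
  k_pos := hk

/-- The symbol of the instance that a symbol written by the reduction stands for. -/
def decodeSymbol : Symbol → Option Bool
  | .tally => some true
  | .pos => some true
  | .neg => some false
  | .sep => none

theorem map_decodeSymbol_bits (v : List Bool) :
    (StackProg.bits v).map decodeSymbol = v.map some := by
  rw [StackProg.bits, List.map_map]
  exact List.map_congr_left fun b _ => by cases b <;> rfl

theorem List.map_range_getD {α : Type*} (l : List α) (d : α) :
    (List.range l.length).map (fun i => l.getD i d) = l := by
  apply List.ext_getElem
  · simp
  · intro i h₁ h₂
    simp [h₂]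

theorem rowAdj_lt_lt {R : List (List Bool)} {a b : ℕ} (ha : a < R.length) (hb : b < R.length) :
    rowAdj R a b = false := by
  simp [rowAdj, ha, hb]

theorem rowAdj_lt_add {R : List (List Bool)} {a : ℕ} (p : ℕ) (ha : a < R.length) :
    rowAdj R a (R.length + p) = rowBit R a p := by
  simp [rowAdj, ha]

theorem rowAdj_add_lt {R : List (List Bool)} {b : ℕ} (p : ℕ) (hb : b < R.length) :
    rowAdj R (R.length + p) b = rowBit R b p := by
  rw [rowAdj_comm, rowAdj_lt_add p hb]

theorem rowAdj_add_add (R : List (List Bool)) (p q : ℕ) :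
    rowAdj R (R.length + p) (R.length + q) = false := by
  simp [rowAdj]

/-- The matrix splits into four blocks: two zero blocks on the diagonal, the rows, and their
transpose. -/
theorem map_decodeSymbol_instanceWord {D k : ℕ} (hk : 0 < k) {R : List (List Bool)}
    (hR : ∀ v ∈ R, v.length = D) :
    (StackProg.instanceWord D k R).map decodeSymbol = (rowInstance D k hk R).encode := by
  have hmat : ((List.finRange (R.length + D)).flatMap fun i : Fin (R.length + D) =>
      (List.finRange (R.length + D)).map fun j : Fin (R.length + D) => some (rowAdj R i j)) =
      ((R.flatMap fun v => List.replicate R.length Symbol.neg ++ StackProg.bits v) ++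
      (List.range D).flatMap fun d =>
        StackProg.bits (R.map fun v => v.getD d false) ++ List.replicate D Symbol.neg).map
          decodeSymbol := by
    have h₁ : ∀ i : ℕ, ((List.finRange (R.length + D)).map fun j : Fin (R.length + D) =>
        some (rowAdj R i j)) = (List.range (R.length + D)).map fun j => some (rowAdj R i j) := by
      intro i
      rw [← List.map_coe_finRange_eq_range, List.map_map]
      rfl
    have h₂ : ((List.finRange (R.length + D)).flatMap fun i : Fin (R.length + D) =>
        (List.finRange (R.length + D)).map fun j : Fin (R.length + D) =>
        some (rowAdj R i j)) = (List.range (R.length + D)).flatMap fun i =>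
          (List.range (R.length + D)).map fun j => some (rowAdj R i j) := by
      simp only [h₁]
      rw [← List.map_coe_finRange_eq_range, List.flatMap_map]
    rw [h₂, List.map_append, List.map_flatMap, List.map_flatMap, List.range_add,
      List.flatMap_append, List.flatMap_map]
    congr 1
    · conv_rhs => rw [← List.map_range_getD R []]
      rw [List.flatMap_map]
      refine List.flatMap_congr fun i hi => ?_
      rw [List.mem_range] at hi
      rw [List.map_append, List.map_append, map_decodeSymbol_bits, List.map_replicate,
        List.map_map]
      have hl : (R.getD i []).length = D := hR _ (by simp [hi])
      congr 1
      · rw [List.eq_replicate_iff]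
        refine ⟨by simp, fun b hb => ?_⟩
        obtain ⟨j, hj, rfl⟩ := List.mem_map.mp hb
        rw [rowAdj_lt_lt hi (List.mem_range.mp hj)]
        rfl
      · conv_rhs => rw [← List.map_range_getD (R.getD i []) false, hl, List.map_map]
        refine List.map_congr_left fun p _ => ?_
        simp only [Function.comp_apply]
        rw [rowAdj_lt_add p hi]
        rfl
    · refine List.flatMap_congr fun d hd => ?_
      rw [List.map_append, List.map_append, map_decodeSymbol_bits, List.map_replicate,
        List.map_map]
      congr 1
      · conv_rhs => rw [← List.map_range_getD R [], List.map_map, List.map_map]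
        refine List.map_congr_left fun j hj => ?_
        simp only [Function.comp_apply]
        rw [rowAdj_add_lt d (List.mem_range.mp hj)]
        rfl
      · rw [List.eq_replicate_iff]
        refine ⟨by simp, fun b hb => ?_⟩
        obtain ⟨j, hj, rfl⟩ := List.mem_map.mp hb
        simp only [Function.comp_apply]
        rw [rowAdj_add_add]
        rfl
  -- The encoding decides adjacency classically, so the decision has to be identified with the
  -- Boolean `rowAdj`.
  have hadj : ∀ i j : Fin (rowInstance D k hk R).n,
      (@decide ((rowInstance D k hk R).G.Adj i j) (Classical.propDecidable _)) =
        rowAdj R i j := by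
    intro i j
    by_cases h : rowAdj R i j = true
    · rw [h]
      exact @decide_eq_true _ (Classical.propDecidable _) h
    · rw [Bool.not_eq_true] at h
      rw [h]
      exact @decide_eq_false _ (Classical.propDecidable _) (by
        change ¬ rowAdj R i j = true
        simp [h])
  simp only [StackProg.instanceWord, MMDSInstance.encode, List.map_append, hadj]
  rw [List.map_append] at hmat
  rw [← hmat]
  simp [decodeSymbol, rowInstance]

/-! ### Dominating sets in graphs given by rows -/

theorem encard_rows_eq_count (R : List (List Bool)) (v : List Bool) :
    {j : Fin R.length | R[j] = v}.encard = R.count v := by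
  have h := Fin.card_filter_univ_eq_vector_get_eq_count v ⟨R, rfl⟩
  simp only [List.Vector.toList_mk] at h
  -- The two sides count with different, but both lawful, `BEq` instances.
  have h' : @List.count _ instBEqOfDecidableEq v R = R.count v := by
    congr 1
    exact lawful_beq_subsingleton _ _
  rw [← h', ← h, ← Set.encard_coe_eq_coe_finsetCard]
  congr 1
  ext j
  rw [Finset.mem_coe, Finset.mem_filter]
  exact (and_iff_right (Finset.mem_univ j)).symm

section Domination

variable {D k : ℕ} {hk : 0 < k} {R : List (List Bool)}

/-- The vertex of a row. -/
def rowVertex (D k : ℕ) (hk : 0 < k) (R : List (List Bool)) (j : Fin R.length) :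
    Fin (rowInstance D k hk R).n :=
  Fin.castAdd D j

/-- The vertex of a position. -/
def positionVertex (k : ℕ) (hk : 0 < k) (R : List (List Bool)) {D : ℕ} (p : Fin D) :
    Fin (rowInstance D k hk R).n :=
  Fin.natAdd R.length p

theorem rowVertex_injective : Function.Injective (rowVertex D k hk R) :=
  Fin.castAdd_injective _ _

theorem positionVertex_injective :
    Function.Injective (positionVertex k hk R : Fin D → Fin (rowInstance D k hk R).n) :=
  Fin.natAdd_injective _ _

theorem rowVertex_ne_positionVertex (j : Fin R.length) (p : Fin D) :
    rowVertex D k hk R j ≠ positionVertex k hk R p := by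
  intro h
  have := congrArg Fin.val h
  simp only [rowVertex, positionVertex, Fin.val_castAdd, Fin.val_natAdd] at this
  omega

theorem vertex_cases (u : Fin (rowInstance D k hk R).n) :
    (∃ j, u = rowVertex D k hk R j) ∨ ∃ p, u = positionVertex k hk R p := by
  refine Fin.addCases (fun j => .inl ⟨j, rfl⟩) (fun p => .inr ⟨p, rfl⟩) u

theorem not_adj_rowVertex_rowVertex (i j : Fin R.length) :
    ¬ (rowInstance D k hk R).G.Adj (rowVertex D k hk R i) (rowVertex D k hk R j) := by
  change ¬ rowAdj R i j = true
  rw [rowAdj_lt_lt i.2 j.2]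
  simp

theorem not_adj_positionVertex_positionVertex (p q : Fin D) :
    ¬ (rowInstance D k hk R).G.Adj (positionVertex k hk R p) (positionVertex k hk R q) := by
  change ¬ rowAdj R (R.length + p) (R.length + q) = true
  rw [rowAdj_add_add]
  simp

theorem adj_rowVertex_positionVertex (j : Fin R.length) (p : Fin D) :
    (rowInstance D k hk R).G.Adj (rowVertex D k hk R j) (positionVertex k hk R p) ↔
      R[j].getD p false = true := by
  change rowAdj R j (R.length + p) = true ↔ _
  rw [rowAdj_lt_add _ j.2, rowBit, List.getD_eq_getElem _ _ j.2]
  rfl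

/-- No two rows are adjacent, so the positions cover all edges, however many copies of rows there
are. -/
theorem vc_rowInstance_le : (rowInstance D k hk R).vc ≤ D := by
  have hc : (rowInstance D k hk R).G.IsVertexCover
      (Set.range (positionVertex k hk R : Fin D → Fin (rowInstance D k hk R).n)) := by
    intro u v h
    rcases vertex_cases u with ⟨i, rfl⟩ | ⟨p, rfl⟩
    · rcases vertex_cases v with ⟨j, rfl⟩ | ⟨q, rfl⟩
      · exact absurd h (not_adj_rowVertex_rowVertex i j)
      · exact .inr ⟨q, rfl⟩
    · exact .inl ⟨p, rfl⟩
  have h := hc.vertexCoverNum_le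
  rw [← Set.image_univ, positionVertex_injective.encard_image, Set.encard_univ,
    ENat.card_eq_coe_fintype_card, Fintype.card_fin] at h
  exact ENat.toNat_le_of_le_natCast h

/-- A row that occurs often is hit by the positions of a set with small membership. -/
theorem exists_position_of_count {S : Set (Fin (rowInstance D k hk R).n)}
    (hS : (rowInstance D k hk R).G.IsDominatingSet S)
    (hm : ∀ u, (rowInstance D k hk R).G.membership u S ≤ (k : ℕ∞)) {v : List Bool}
    (hv : k < R.count v) {p₀ : Fin D} (hp₀ : v.getD p₀ false = true) :
    ∃ p : Fin D, v.getD p false = true ∧ positionVertex k hk R p ∈ S := by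
  by_contra! hno
  -- No neighbour of a copy of `v` is in `S`, so each copy dominates itself; all of them are then in
  -- `S` and adjacent to `p₀`.
  have hsub : rowVertex D k hk R '' {j : Fin R.length | R[j] = v} ⊆
      insert (positionVertex k hk R p₀)
        ((rowInstance D k hk R).G.neighborSet (positionVertex k hk R p₀)) ∩ S := by
    rintro _ ⟨j, hj, rfl⟩
    have hj' : R[j] = v := hj
    refine ⟨.inr ((adj_rowVertex_positionVertex j p₀).mpr (by rwa [hj'])).symm, ?_⟩
    rcases hS (rowVertex D k hk R j) with h | ⟨u, hu, h⟩
    · exact h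
    · rcases vertex_cases u with ⟨i, rfl⟩ | ⟨p, rfl⟩
      · exact absurd h (not_adj_rowVertex_rowVertex j i)
      · have hp := (adj_rowVertex_positionVertex j p).mp h
        rw [hj'] at hp
        exact absurd hu (hno p hp)
  have h := (Set.encard_le_encard hsub).trans (hm _)
  rw [rowVertex_injective.encard_image, encard_rows_eq_count] at h
  exact absurd (ENat.natCast_le_natCast.mp h) (by omega)

/-- The number of positions of a set with small membership is small when there is a full row. -/
theorem encard_positions_le {S : Set (Fin (rowInstance D k hk R).n)}
    (hm : ∀ u, (rowInstance D k hk R).G.membership u S ≤ (k : ℕ∞)) {v : List Bool}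
    (hv : v ∈ R) (hv' : ∀ p : Fin D, v.getD p false = true) :
    {p : Fin D | positionVertex k hk R p ∈ S}.encard ≤ k := by
  obtain ⟨j, hj, rfl⟩ := List.getElem_of_mem hv
  rw [← (positionVertex_injective (hk := hk) (R := R)).encard_image]
  refine (Set.encard_le_encard ?_).trans (hm (rowVertex D k hk R ⟨j, hj⟩))
  rintro _ ⟨p, hp, rfl⟩
  exact ⟨.inr ((adj_rowVertex_positionVertex ⟨j, hj⟩ p).mpr (hv' p)), hp⟩

/-- A set of positions that hits all rows, together with one row for each pair of positions. -/
theorem isYes_of_choice (hD : D = 2 * k) (hk₂ : 2 ≤ k) (a : ℕ → Bool)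
    (hhit : ∀ v ∈ R, ∃ p : Fin D, v.getD p false = true ∧ decide ((p : ℕ) % 2 = 0) = a (p / 2))
    (hpair : ∀ i < k, ∃ v ∈ R, ∀ p : Fin D, v.getD p false = true ↔ (p : ℕ) / 2 = i) :
    (rowInstance D k hk R).IsYes := by
  have hpair' : ∀ i : Fin k, ∃ j : Fin R.length,
      ∀ p : Fin D, R[j].getD p false = true ↔ (p : ℕ) / 2 = i := by
    intro i
    obtain ⟨v, hv, h⟩ := hpair i i.2
    obtain ⟨j, hj, rfl⟩ := List.getElem_of_mem hv
    exact ⟨⟨j, hj⟩, h⟩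
  choose c hc using hpair'
  let P : Set (Fin D) := {p | decide ((p : ℕ) % 2 = 0) = a (p / 2)}
  -- A chosen position is determined by its pair, since `a` fixes the parity; hence at most `k` are
  -- chosen.
  have hPinj : ∀ p ∈ P, ∀ q ∈ P, (p : ℕ) / 2 = q / 2 → p = q := by
    intro p hp q hq h
    have h' : decide ((p : ℕ) % 2 = 0) = decide ((q : ℕ) % 2 = 0) := by
      rw [show _ = _ from hp, show _ = _ from hq, h]
    rw [decide_eq_decide] at h'
    ext
    omega
  have hP : P.encard ≤ k := by
    have hlt (p : Fin D) : (p : ℕ) / 2 < k := by omega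
    have hi : Set.InjOn (fun p : Fin D => (⟨(p : ℕ) / 2, hlt p⟩ : Fin k)) P :=
      fun p hp q hq h => hPinj p hp q hq (congrArg Fin.val h)
    rw [← hi.encard_image]
    refine (Set.encard_le_encard (Set.subset_univ _)).trans ?_
    simp [Set.encard_univ]
  have h₂ : (2 : ℕ∞) ≤ k := by exact_mod_cast hk₂
  let S : Set (Fin (rowInstance D k hk R).n) :=
    positionVertex k hk R '' P ∪ Set.range fun i => rowVertex D k hk R (c i)
  have hSp (p : Fin D) : positionVertex k hk R p ∈ S ↔ p ∈ P := by
    refine ⟨?_, fun h => .inl ⟨p, h, rfl⟩⟩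
    rintro (⟨q, hq, h⟩ | ⟨i, h⟩)
    · rwa [← positionVertex_injective h]
    · exact absurd h (rowVertex_ne_positionVertex _ _)
  have hSr (j : Fin R.length) : rowVertex D k hk R j ∈ S ↔ ∃ i, c i = j := by
    refine ⟨?_, fun ⟨i, h⟩ => .inr ⟨i, by rw [← h]⟩⟩
    rintro (⟨q, hq, h⟩ | ⟨i, h⟩)
    · exact absurd h.symm (rowVertex_ne_positionVertex _ _)
    · exact ⟨i, rowVertex_injective h⟩
  refine ⟨S, fun u => ?_, fun u => ?_⟩
  -- Every vertex even has a neighbour in `S`: a row by `hhit`, a position in the chosen row of its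
  -- pair.
  · right
    rcases vertex_cases u with ⟨j, rfl⟩ | ⟨p, rfl⟩
    · obtain ⟨p, hp, hp'⟩ := hhit R[j] (List.getElem_mem _)
      exact ⟨positionVertex k hk R p, (hSp p).mpr hp', (adj_rowVertex_positionVertex j p).mpr hp⟩
    · have hlt : (p : ℕ) / 2 < k := by omega
      exact ⟨rowVertex D k hk R (c ⟨p / 2, hlt⟩), (hSr _).mpr ⟨_, rfl⟩,
        ((adj_rowVertex_positionVertex _ p).mpr ((hc _ p).mpr rfl)).symm⟩
  · rcases vertex_cases u with ⟨j, rfl⟩ | ⟨p, rfl⟩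
    · by_cases hj : ∃ i, c i = j
      · obtain ⟨i, rfl⟩ := hj
        -- A chosen row sees itself and the single chosen position of its pair.
        refine le_trans ?_ h₂
        rw [SimpleGraph.membership, Set.insert_inter_of_mem ((hSr _).mpr ⟨i, rfl⟩)]
        refine (Set.encard_insert_le _ _).trans ?_
        have : ((rowInstance D k hk R).G.neighborSet (rowVertex D k hk R (c i)) ∩ S).encard ≤ 1 := by
          rw [Set.encard_le_one_iff]
          rintro u v ⟨hu, hu'⟩ ⟨hv, hv'⟩
          rcases vertex_cases u with ⟨j, rfl⟩ | ⟨p, rfl⟩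
          · exact absurd hu (not_adj_rowVertex_rowVertex _ _)
          rcases vertex_cases v with ⟨j, rfl⟩ | ⟨q, rfl⟩
          · exact absurd hv (not_adj_rowVertex_rowVertex _ _)
          rw [hPinj p ((hSp p).mp hu') q ((hSp q).mp hv')]
          rw [(hc i p).mp ((adj_rowVertex_positionVertex _ p).mp hu),
            (hc i q).mp ((adj_rowVertex_positionVertex _ q).mp hv)]
        calc _ ≤ (1 : ℕ∞) + 1 := by gcongr
          _ = 2 := by norm_num
      -- A row that is not chosen sees chosen positions only.
      · refine le_trans ?_ hP
        rw [← (positionVertex_injective (hk := hk) (R := R)).encard_image]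
        refine Set.encard_le_encard ?_
        rintro u ⟨rfl | hu, hu'⟩
        · exact absurd ((hSr _).mp hu') hj
        · rcases vertex_cases u with ⟨i, rfl⟩ | ⟨p, rfl⟩
          · exact absurd hu (not_adj_rowVertex_rowVertex _ _)
          · exact ⟨p, (hSp p).mp hu', rfl⟩
    -- A position sees at most itself and the chosen row of its pair, as the other chosen rows
    -- belong to other pairs.
    · refine le_trans ?_ h₂
      have hlt : (p : ℕ) / 2 < k := by omega
      refine (Set.encard_le_encard (t := {positionVertex k hk R p,
        rowVertex D k hk R (c ⟨p / 2, hlt⟩)}) ?_).trans ((Set.encard_insert_le _ _).trans ?_)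
      · rintro u ⟨rfl | hu, hu'⟩
        · exact .inl rfl
        · rcases vertex_cases u with ⟨j, rfl⟩ | ⟨q, rfl⟩
          · obtain ⟨i, rfl⟩ := (hSr _).mp hu'
            right
            have := (hc i p).mp ((adj_rowVertex_positionVertex _ p).mp hu.symm)
            have hi : i = ⟨p / 2, hlt⟩ := Fin.ext this.symm
            rw [hi]
            rfl
          · exact absurd hu (not_adj_positionVertex_positionVertex _ _)
      · rw [Set.encard_singleton]
        norm_num

end Domination

/-! ### Correctness of the reduction -/

namespace StackProg

theorem getD_replicate_false (n p : ℕ) : (List.replicate n false).getD p false = false := by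
  rw [List.getD_eq_getElem?_getD, List.getElem?_replicate]
  split_ifs <;> rfl

theorem getD_pairRow {D i : ℕ} (p : ℕ) :
    (pairRow D i).getD p false = true ↔ p / 2 = i := by
  rw [pairRow]
  rcases lt_or_ge p (2 * i) with h | h
  · rw [List.getD_append _ _ _ _ (by simpa using h)]
    simp only [getD_replicate_false, Bool.false_eq_true, false_iff]
    omega
  · rw [List.getD_append_right _ _ _ _ (by simpa using h), List.length_replicate]
    obtain ⟨q, rfl⟩ := Nat.exists_eq_add_of_le h
    rw [Nat.add_sub_cancel_left]
    rcases q with _ | _ | q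
    · simp
    · simp; omega
    · simp only [List.getD_cons_succ, getD_replicate_false, Bool.false_eq_true, false_iff]
      omega

theorem getD_unitRow {D : ℕ} (p : ℕ) : (unitRow D).getD p false = true ↔ p = 1 := by
  rcases p with _ | _ | p
  · simp [unitRow]
  · simp [unitRow]
  · simp only [unitRow, List.getD_cons_succ, getD_replicate_false, Bool.false_eq_true,
      false_iff]
    omega

theorem getD_fullRow {D p : ℕ} (hp : p < D) : (fullRow D).getD p false = true := by
  rw [fullRow, List.getD_eq_getElem _ _ (by simpa using hp)]
  simp

theorem getD_emptyClauseRow {D : ℕ} (p : ℕ) :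
    (emptyClauseRow D).getD p false = true ↔ p = 0 := by
  rcases p with _ | p
  · simp [emptyClauseRow]
  · simp only [emptyClauseRow, List.getD_cons_succ, getD_replicate_false,
      Bool.false_eq_true, false_iff]
    omega

theorem literalPosition_lt {n : ℕ} (l : Fin n × Bool) : literalPosition l < 2 * n + 4 := by
  rw [literalPosition]
  have := l.1.2
  split_ifs <;> omega

theorem getD_clauseRow {n D : ℕ} (hD : D = 2 * n + 4) (c : List (Fin n × Bool)) (p : ℕ) :
    (clauseRow D c).getD p false = true ↔ p = 0 ∨ ∃ l ∈ c, literalPosition l = p := by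
  have h : ∀ v : List Bool, v.length = D →
      ((c.foldl (fun v l => v.set (literalPosition l) true) v).getD p false = true ↔
        v.getD p false = true ∨ ∃ l ∈ c, literalPosition l = p) := by
    induction c with
    | nil => simp
    | cons l c ih =>
      intro v hv
      have hl : literalPosition l < v.length := by
        rw [hv, hD]
        exact literalPosition_lt l
      rw [List.foldl_cons, ih _ (by simpa using hv)]
      have : (v.set (literalPosition l) true).getD p false = true ↔
          v.getD p false = true ∨ literalPosition l = p := by
        by_cases h : literalPosition l = p
        · subst h
          simp [hl]
        · simp [h]
      rw [this]
      simp only [List.mem_cons, exists_eq_or_imp, or_assoc]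
  rw [clauseRow, h _ (by simp [emptyClauseRow]; omega), getD_emptyClauseRow]

theorem count_le_count_stackRows (D : ℕ) (base R : List (List Bool)) (v : List Bool) :
    R.count v ≤ (stackRows D base R).count v := by
  induction base generalizing R with
  | nil => rfl
  | cons u base ih =>
    refine le_trans ?_ (ih _)
    rw [List.count_append]
    omega

theorem le_count_stackRows {D : ℕ} {base R : List (List Bool)} {v : List Bool} (hv : v ∈ base) :
    D ≤ (stackRows D base R).count v := by
  induction base generalizing R with
  | nil => simp at hv
  | cons u base ih =>
    rcases List.mem_cons.mp hv with rfl | h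
    · refine le_trans ?_ (count_le_count_stackRows D base (List.replicate D v ++ R) v)
      rw [List.count_append, List.count_replicate_self]
      omega
    · exact ih h

end StackProg

/-! ### The instance of a formula: equivalence and size -/

namespace ThreeCNF

open StackProg

/-- The instance of Minimum Membership Dominating Set that the reduction makes from a formula. -/
def toInstance (φ : ThreeCNF) : MMDSInstance :=
  rowInstance φ.numLiterals (φ.n + 2) (by omega) φ.graphRows

theorem mem_graphRows {φ : ThreeCNF} {v : List Bool} (hv : v ∈ φ.baseRows) : v ∈ φ.graphRows := by
  have h : φ.numLiterals ≤ φ.graphRows.count v := le_count_stackRows hv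
  rw [numLiterals] at h
  exact List.count_pos_iff.mp (by omega)

theorem pairRow_mem_baseRows (φ : ThreeCNF) {i : ℕ} (hi : i < φ.n + 2) :
    pairRow φ.numLiterals i ∈ φ.baseRows :=
  List.mem_append_left _ (List.mem_map.mpr ⟨i, List.mem_range.mpr hi, rfl⟩)

theorem unitRow_mem_baseRows (φ : ThreeCNF) : unitRow φ.numLiterals ∈ φ.baseRows := by
  simp [baseRows]

theorem fullRow_mem_baseRows (φ : ThreeCNF) : fullRow φ.numLiterals ∈ φ.baseRows := by
  simp [baseRows]

theorem clauseRow_mem_baseRows (φ : ThreeCNF) {c : List (Fin φ.n × Bool)} (hc : c ∈ φ.clauses) :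
    clauseRow φ.numLiterals c ∈ φ.baseRows :=
  List.mem_append_right _ (List.mem_append_right _ (List.mem_map.mpr ⟨c, hc, rfl⟩))

theorem Satisfiable.isYes_toInstance {φ : ThreeCNF} (h : φ.Satisfiable) : φ.toInstance.IsYes := by
  obtain ⟨τ, hτ⟩ := h
  -- Pair `0` takes its odd position `1`, to hit the unit row. The value at pair `1` is immaterial;
  -- there `i - 2` truncates to `0`.
  let a : ℕ → Bool := fun i =>
    if i = 0 then false else if h : i - 2 < φ.n then τ ⟨i - 2, h⟩ else true
  have hD : φ.numLiterals = 2 * φ.n + 4 := rfl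
  refine isYes_of_choice (by rw [hD]; ring) (by omega) a (fun v hv => ?_) (fun i hi => ?_)
  · have hv' : v ∈ φ.baseRows := (mem_stackRows hv).resolve_right List.not_mem_nil
    simp only [baseRows, List.mem_append, List.mem_map, List.mem_range, List.mem_cons,
      List.not_mem_nil, or_false] at hv'
    rcases hv' with ⟨i, hi, rfl⟩ | (rfl | rfl) | ⟨c, hc, rfl⟩
    · refine ⟨⟨2 * i + if a i then 0 else 1, by rw [hD]; split_ifs <;> omega⟩, ?_, ?_⟩
      · rw [getD_pairRow]
        simp only
        split_ifs <;> omega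
      · simp only
        cases ha : a i
        · simp only [Bool.false_eq_true, if_false]
          rw [show (2 * i + 1) / 2 = i by omega, ha]
          exact decide_eq_false (by omega)
        · simp only [if_true]
          rw [show (2 * i + 0) / 2 = i by omega, ha]
          exact decide_eq_true (by omega)
    · exact ⟨⟨1, by omega⟩, (getD_unitRow _).mpr rfl, by simp [a]⟩
    · exact ⟨⟨1, by omega⟩, getD_fullRow (by simp only; omega), by simp [a]⟩
    · obtain ⟨⟨⟨i, hi⟩, b⟩, hl, hb⟩ := hτ c hc
      refine ⟨⟨literalPosition (⟨i, hi⟩, b), by rw [hD]; exact literalPosition_lt _⟩,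
        (getD_clauseRow hD c _).mpr (.inr ⟨_, hl, rfl⟩), ?_⟩
      simp only at hb
      have ha : a (i + 2) = b := by simp [a, hi, hb]
      simp only [literalPosition]
      cases b
      · simp only [Bool.false_eq_true, if_false]
        rw [show (2 * i + 4 + 1) / 2 = i + 2 by omega, ha]
        exact decide_eq_false (by omega)
      · simp only [if_true]
        rw [show (2 * i + 4 + 0) / 2 = i + 2 by omega, ha]
        exact decide_eq_true (by omega)
  · exact ⟨_, mem_graphRows (φ.pairRow_mem_baseRows hi), fun p => getD_pairRow _⟩

/-- The chosen positions hit every row and are at most as many as the pairs, so they select one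
literal of each variable; the assignment is read from the even positions. -/
theorem satisfiable_of_isYes_toInstance {φ : ThreeCNF} (h : φ.toInstance.IsYes) :
    φ.Satisfiable := by
  classical
  obtain ⟨S, hS, hm⟩ := h
  have hD : φ.numLiterals = 2 * φ.n + 4 := rfl
  have hcount {v : List Bool} (hv : v ∈ φ.baseRows) : φ.n + 2 < φ.graphRows.count v := by
    have : φ.numLiterals ≤ φ.graphRows.count v := le_count_stackRows hv
    omega
  let T : Finset ℕ := (Finset.univ.filter fun p : Fin φ.numLiterals =>
    positionVertex (φ.n + 2) (Nat.succ_pos _) φ.graphRows p ∈ S).map Fin.valEmbedding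
  have hhit {v : List Bool} (hv : v ∈ φ.baseRows) {p₀ : ℕ} (hp₀ : p₀ < φ.numLiterals)
      (h : v.getD p₀ false = true) : ∃ p ∈ T, v.getD p false = true := by
    obtain ⟨p, hp, hp'⟩ := exists_position_of_count hS hm (hcount hv) (p₀ := ⟨p₀, hp₀⟩) h
    exact ⟨p, Finset.mem_map.mpr ⟨p, Finset.mem_filter.mpr ⟨Finset.mem_univ p, hp'⟩, rfl⟩, hp⟩
  have hcard : T.card ≤ φ.n + 2 := by
    have h := encard_positions_le hm (mem_graphRows φ.fullRow_mem_baseRows)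
      (fun p => getD_fullRow p.2)
    rw [Finset.card_map, ← ENat.natCast_le_natCast, ← Set.encard_coe_eq_coe_finsetCard]
    refine le_trans (le_of_eq (congrArg _ ?_)) h
    ext p
    rw [Finset.mem_coe, Finset.mem_filter]
    exact and_iff_right (Finset.mem_univ p)
  have hpair {i : ℕ} (hi : i < φ.n + 2) : ∃ p ∈ T, p / 2 = i := by
    obtain ⟨p, hp, h⟩ := hhit (φ.pairRow_mem_baseRows hi) (p₀ := 2 * i) (by omega)
      ((getD_pairRow _).mpr (by omega))
    exact ⟨p, hp, (getD_pairRow _).mp h⟩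
  -- If both positions of a pair were chosen, one could be dropped and all `n + 2` pairs would still
  -- be hit, by at most `n + 1` positions.
  have hexcl {i : ℕ} (h₀ : 2 * i ∈ T) (h₁ : 2 * i + 1 ∈ T) : False := by
    have hsub : Finset.range (φ.n + 2) ⊆ (T.erase (2 * i + 1)).image (· / 2) := by
      intro j hj
      rw [Finset.mem_image]
      by_cases hji : j = i
      · exact ⟨2 * i, Finset.mem_erase.mpr ⟨by omega, h₀⟩, by omega⟩
      · obtain ⟨p, hp, h⟩ := hpair (Finset.mem_range.mp hj)
        exact ⟨p, Finset.mem_erase.mpr ⟨by omega, hp⟩, h⟩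
    have h := (Finset.card_le_card hsub).trans Finset.card_image_le
    rw [Finset.card_range, Finset.card_erase_of_mem h₁] at h
    have := Finset.card_pos.mpr ⟨_, h₁⟩
    omega
  have h₁ : 1 ∈ T := by
    obtain ⟨p, hp, h⟩ := hhit φ.unitRow_mem_baseRows (p₀ := 1) (by omega)
      ((getD_unitRow _).mpr rfl)
    rwa [(getD_unitRow _).mp h] at hp
  refine ⟨fun i => decide (2 * (i : ℕ) + 4 ∈ T), fun c hc => ?_⟩
  -- Position `0` witnesses that the row is nonempty, even for an empty clause; it cannot be the
  -- position hit, because `1` is chosen.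
  obtain ⟨p, hp, h⟩ := hhit (φ.clauseRow_mem_baseRows hc) (p₀ := 0) (by omega)
    ((getD_clauseRow hD c _).mpr (.inl rfl))
  rcases (getD_clauseRow hD c _).mp h with rfl | ⟨⟨i, b⟩, hl, rfl⟩
  · exact absurd h₁ fun h₁ => hexcl (i := 0) hp h₁
  · refine ⟨_, hl, ?_⟩
    simp only [literalPosition] at hp ⊢
    cases b
    · simp only [Bool.false_eq_true, if_false] at hp
      exact decide_eq_false fun h => hexcl (i := i + 2) (by rwa [Nat.mul_add]) (by rwa [Nat.mul_add])
    · exact decide_eq_true (by simpa using hp)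

theorem isYes_toInstance_iff (φ : ThreeCNF) : φ.toInstance.IsYes ↔ φ.Satisfiable :=
  ⟨satisfiable_of_isYes_toInstance, Satisfiable.isYes_toInstance⟩

theorem vc_toInstance_le (φ : ThreeCNF) : φ.toInstance.vc ≤ 2 * φ.n + 4 :=
  vc_rowInstance_le

theorem n_toInstance_le (φ : ThreeCNF) : φ.toInstance.n ≤ 20 * (φ.n + φ.m + 1) ^ 2 := by
  change φ.graphRows.length + φ.numLiterals ≤ _
  rw [length_graphRows, numLiterals]
  nlinarith

/-- The transfer to the decision machine takes one step per symbol of this word. -/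
theorem length_encode_toInstance_le (φ : ThreeCNF) :
    φ.toInstance.encode.length ≤ 500 * (φ.n + φ.m + 1) ^ 4 := by
  have hl : φ.toInstance.encode.length =
      φ.toInstance.n + φ.toInstance.n * φ.toInstance.n + (φ.n + 2) + 2 := by
    simp [MMDSInstance.encode, List.length_flatMap]
    simp [toInstance, rowInstance]
    ring
  have hn := φ.n_toInstance_le
  have hnn := Nat.mul_le_mul hn hn
  have hX : 1 ≤ φ.n + φ.m + 1 := by omega
  have hX₂ : φ.n + 2 ≤ 2 * (φ.n + φ.m + 1) := by omega
  rw [hl]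
  generalize φ.n + φ.m + 1 = X at *
  have p₀ : 1 ≤ X ^ 4 := Nat.one_le_pow _ _ hX
  have p₁ : X ≤ X ^ 4 := Nat.le_self_pow (by norm_num) X
  have p₂ : X ^ 2 ≤ X ^ 4 := Nat.pow_le_pow_right hX (by norm_num)
  have e : 20 * X ^ 2 * (20 * X ^ 2) = 400 * X ^ 4 := by ring
  omega

/-- Deciding a formula by means of a machine for Minimum Membership Dominating Set. -/
theorem exists_answersWithin (M : DecisionTM (Option Bool)) :
    ∃ M' : DecisionTM Symbol, ∀ (φ : ThreeCNF) (t : ℕ),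
      M.AnswersWithin φ.toInstance.encode φ.toInstance.IsYes t →
      ∃ t' ≤ 11000 * (φ.n + φ.m + 1) ^ 4 + t, M'.AnswersWithin φ.encode φ.Satisfiable t' := by
  refine ⟨reduction.thenTM .inp .out decodeSymbol M, fun φ t h => ?_⟩
  obtain ⟨s, ⟨t₁, ht₁, hr⟩, hs⟩ := φ.runsIn_reduction
  have hw : (s .out).reverse.map decodeSymbol = φ.toInstance.encode := by
    rw [hs]
    exact map_decodeSymbol_instanceWord _ fun v hv => length_of_mem_graphRows hv
  have hl : (s .out).length ≤ 500 * (φ.n + φ.m + 1) ^ 4 := by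
    have := congrArg List.length hw
    rw [List.length_map, List.length_reverse] at this
    rw [this]
    exact φ.length_encode_toInstance_le
  rw [← hw, propext φ.isYes_toInstance_iff] at h
  have hX : 1 ≤ (φ.n + φ.m + 1) ^ 4 := Nat.one_le_pow _ _ (by omega)
  -- The reduction costs `10000 X ^ 4` and the transfer `500 X ^ 4 + 1`, where `X = n + m + 1`.
  exact ⟨_, by omega, hr.answersWithin h⟩

end ThreeCNF

/-! ### The final estimate -/

/-- A sublinear function is at most `ε * v` up to a constant. -/
theorem Asymptotics.IsLittleO.exists_le_mul_add {f : ℕ → ℝ}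
    (hf : f =o[atTop] fun v : ℕ => (v : ℝ)) {ε : ℝ} (hε : 0 < ε) :
    ∃ K : ℝ, ∀ v : ℕ, f v ≤ ε * v + K := by
  obtain ⟨N, hN⟩ := eventually_atTop.mp (hf.def hε)
  -- The sum bounds `f` at each of the finitely many arguments below the threshold.
  refine ⟨∑ v ∈ Finset.range N, |f v|, fun v => ?_⟩
  have h₀ : 0 ≤ ∑ v ∈ Finset.range N, |f v| := Finset.sum_nonneg fun _ _ => abs_nonneg _
  rcases lt_or_ge v N with h | h
  · have h₁ : |f v| ≤ ∑ v ∈ Finset.range N, |f v| :=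
      Finset.single_le_sum (f := fun v => |f v|) (fun _ _ => abs_nonneg _) (Finset.mem_range.mpr h)
    have h₂ : 0 ≤ ε * v := by positivity
    linarith [le_abs_self (f v)]
  · have h₁ := hN v h
    rw [Real.norm_eq_abs, Real.norm_eq_abs, Nat.abs_cast] at h₁
    linarith [le_abs_self (f v)]

/-- Assuming ETH, Minimum Membership Dominating Set has no algorithm that runs in time
`2 ^ o(vc) * |V| ^ O(1)`, where `vc` is the vertex cover number. (The `+ 1` makes the bound positive
on the empty graph, too.) -/
theorem theorem5 (hETH : ExponentialTimeHypothesis) :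
    ¬ ∃ f : ℕ → ℝ, f =o[atTop] (fun v : ℕ => (v : ℝ)) ∧ ∃ (C : ℝ) (c : ℕ),
      DecidableInTime MMDSInstance.encode MMDSInstance.IsYes
        (fun I => C * (2 : ℝ) ^ f I.vc * ((I.n : ℝ) + 1) ^ c) := by
  rintro ⟨f, hf, C, c, M, hM⟩
  obtain ⟨δ, hδ, hno⟩ := hETH
  -- The rate `δ / 2` compensates for the factor two in `vc ≤ 2 n + 4`.
  obtain ⟨K, hK⟩ := hf.exists_le_mul_add (half_pos hδ)
  obtain ⟨M', hM'⟩ := ThreeCNF.exists_answersWithin M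
  -- The exponent `2 δ + K` is what remains of `(δ / 2) (2 n + 4) + K` besides `δ n`. The factor `21
  -- ^ c` comes from `20 X ^ 2 + 1 ≤ 21 X ^ 2`, and `2 c + 4` dominates both exponents of `X`.
  refine hno ⟨11000 + |C| * (2 : ℝ) ^ (2 * δ + K) * 21 ^ c, 2 * c + 4, M', fun φ => ?_⟩
  obtain ⟨t, ht, hMt⟩ := hM φ.toInstance
  obtain ⟨t', ht', hans⟩ := hM' φ t hMt
  refine ⟨t', ?_, hans⟩
  have ht'' : (t' : ℝ) ≤ 11000 * ((φ.n : ℝ) + φ.m + 1) ^ 4 + t := by exact_mod_cast ht'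
  have hn : (φ.toInstance.n : ℝ) ≤ 20 * ((φ.n : ℝ) + φ.m + 1) ^ 2 := by
    exact_mod_cast φ.n_toInstance_le
  have hvc : (φ.toInstance.vc : ℝ) ≤ 2 * φ.n + 4 := by exact_mod_cast φ.vc_toInstance_le
  have hX : (1 : ℝ) ≤ (φ.n : ℝ) + φ.m + 1 := by
    have : (0 : ℝ) ≤ (φ.n : ℝ) + φ.m := by positivity
    linarith
  set X : ℝ := (φ.n : ℝ) + φ.m + 1 with hXdef
  have hE : (1 : ℝ) ≤ (2 : ℝ) ^ (δ * φ.n) := Real.one_le_rpow (by norm_num) (by positivity)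
  have hf₁ : (2 : ℝ) ^ f φ.toInstance.vc ≤ (2 : ℝ) ^ (2 * δ + K) * (2 : ℝ) ^ (δ * φ.n) := by
    rw [← Real.rpow_add (by norm_num)]
    refine Real.rpow_le_rpow_of_exponent_le (by norm_num) ((hK _).trans ?_)
    have := mul_le_mul_of_nonneg_left hvc (half_pos hδ).le
    linarith
  have hn₁ : ((φ.toInstance.n : ℝ) + 1) ^ c ≤ 21 ^ c * X ^ (2 * c) := by
    rw [pow_mul, ← mul_pow]
    refine pow_le_pow_left₀ (by positivity) ?_ c
    have : (1 : ℝ) ≤ X ^ 2 := one_le_pow₀ hX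
    linarith
  have hX₁ : X ^ 4 ≤ X ^ (2 * c + 4) := pow_le_pow_right₀ hX (by omega)
  have hX₂ : X ^ (2 * c) ≤ X ^ (2 * c + 4) := pow_le_pow_right₀ hX (by omega)
  have hX₀ : 0 ≤ X ^ (2 * c + 4) := by positivity
  calc (t' : ℝ) ≤ 11000 * X ^ 4 + t := ht''
    _ ≤ 11000 * X ^ 4 + C * (2 : ℝ) ^ f φ.toInstance.vc * ((φ.toInstance.n : ℝ) + 1) ^ c := by
      linarith
    -- The sign of `C` is unknown, and the next estimate needs a nonnegative factor.
    _ ≤ 11000 * X ^ 4 + |C| * (2 : ℝ) ^ f φ.toInstance.vc * ((φ.toInstance.n : ℝ) + 1) ^ c := by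
      gcongr
      exact le_abs_self C
    _ ≤ 11000 * ((2 : ℝ) ^ (δ * φ.n) * X ^ (2 * c + 4)) +
        |C| * ((2 : ℝ) ^ (2 * δ + K) * (2 : ℝ) ^ (δ * φ.n)) * (21 ^ c * X ^ (2 * c + 4)) := by
      gcongr
      · calc X ^ 4 ≤ X ^ (2 * c + 4) := hX₁
          _ ≤ (2 : ℝ) ^ (δ * φ.n) * X ^ (2 * c + 4) := le_mul_of_one_le_left hX₀ hE
      · exact hn₁.trans (by gcongr)
    _ = _ := by ring
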